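/- All graphs are finite and simple. For a graph $G$, a set $R\subseteq V(G)$ is a *general position set* if for any three distinct vertices of $R$ none of them lies on a geodesic (shortest path) between the other two; the *general position number* $\mathrm{gp}(G)$ is the maximum cardinality of a general position set. A graph is *outerplanar* if it can be drawn in the plane without crossings so that all vertices lie on the boundary of the outer (unbounded) face; equivalently, if it can be drawn in a closed disc with its vertices at distinct points of the bounding circle and its edges as simple arcs in the disc that meet only at common end-vertices. Such a drawing is an *outerplane* graph. It is *maximal* outerplane if for any two distinct non-adjacent vertices $u,v$ the graph $G+uv$ is not outerplanar. An *internal triangle* of a maximal outerplane graph is a triangle (equivalently, an inner face) none of whose edges lies on the boundary of the outer face. A maximal outerplane graph without internal triangles is *striped*. The following graphs have order $n$; $P_k$ denotes the path $p_1p_2\cdots p_k$. * The *straight linear 2-tree* $G_n$ has vertices $v_1,\dots,v_n$, with $v_iv_j$ an edge iff $0<|i-j|\le 2$. * The *fan* $F_{n-1}$ is the join of a single vertex $v$ and the path $P_{n-1}$. * For $n\ge 6$ and $1\le i\le n-3$, $F(i;n)$ is obtained from the fan $F_{n-2}=\{v\}\oplus P_{n-2}$ by adding a new vertex $u$ adjacent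 exactly to $p_i$ and $p_{i+1}$. * For $n\ge 6$, $1\le t\le\lfloor n/3\rfloor-1$ and $1\le j\le t$, let $DF^{j}(t;n)$ be obtained from the fan with centre $v$ and path $p_1\cdots p_{3t}$ and the fan with centre $u$ and path $u_1\cdots u_{n-3t-1}$ by identifying $u$ with $p_{3j-1}$. The graph $G_1(j)$ is obtained from $DF^{j}(t;n)$ by adding the edge $p_{3j-2}u_1$, and $G_2(j)$ by adding the edge $p_{3j}u_{n-3t-1}$. **Theorem.** Let $G$ be a striped maximal outerplane graph of order $n\ge 5$. Then $$3\le \mathrm{gp}(G)\le\left\lfloor\frac{2n}{3}\right\rfloor .$$ Moreover: * $\mathrm{gp}(G)=3$ if and only if $G\cong G_n$. * If $n\not\equiv 1\pmod 3$, then $\mathrm{gp}(G)=\lfloor 2n/3\rfloor$ if and only if $G\cong F_{n-1}$. * If $n\equiv 1\pmod 3$, then $\mathrm{gp}(G)=\lfloor 2n/3\rfloor$ if and only if $G$ is isomorphic to $F_{n-1}$, to $F(1;n)$, to $F(n-3;n)$, or, for some $t$ with $1\le t\le \lfloor n/3\rfloor-1$, to $G_1(1)$ or $G_2(t)$ (built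 from $DF^{1}(t;n)$ and $DF^{t}(t;n)$ respectively). -/

import Mathlib

/-! ### General position sets -/

/-- `R` is a general position set of `G`: for any three distinct vertices of `R`, none of them lies
on a geodesic (a shortest walk) between the other two. -/
def IsGeneralPosition {V : Type*} (G : SimpleGraph V) (R : Finset V) : Prop :=
  ∀ x ∈ R, ∀ y ∈ R, ∀ z ∈ R, x ≠ y → y ≠ z → x ≠ z →
    ∀ w : G.Walk x z, w.length = G.dist x z → y ∉ w.support

/-- The general position number: the largest cardinality of a general position set.
(For a finite graph the set below is nonempty and bounded by the order of `G`.) -/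
noncomputable def gpNumber {V : Type*} (G : SimpleGraph V) : ℕ :=
  sSup {k : ℕ | ∃ R : Finset V, IsGeneralPosition G R ∧ R.card = k}

/-! ### Outerplane graphs -/

/-- An outerplane drawing of `G`, normalised so that the closed region holding the drawing is the
closed unit disc of the plane `ℂ`: the vertices are distinct points of the unit circle, every edge
is a simple arc in the closed disc joining its two ends, an arc contains no vertices other than its
ends, and two different arcs meet at most in vertices. The edges need not be straight. -/
structure OuterplaneDrawing {V : Type*} (G : SimpleGraph V) where
  /-- the point at which a vertex is drawn -/
  pos : V → ℂ
  /-- the arc along which an edge is drawn -/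
  arc : G.edgeSet → Set ℂ
  pos_injective : Function.Injective pos
  norm_pos : ∀ v, ‖pos v‖ = 1
  arc_isArc : ∀ (u v : V) (h : G.Adj u v), ∃ γ : Path (pos u) (pos v),
    Function.Injective γ ∧ Set.range γ = arc ⟨s(u, v), h⟩
  arc_subset : ∀ e, arc e ⊆ Metric.closedBall 0 1
  mem_of_pos_mem_arc : ∀ e v, pos v ∈ arc e → v ∈ e.1
  arc_inter_arc : ∀ e f, e ≠ f → arc e ∩ arc f ⊆ Set.range pos

namespace OuterplaneDrawing

/-- All points of the plane covered by the drawing. -/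
def support {V : Type*} {G : SimpleGraph V} (D : OuterplaneDrawing G) : Set ℂ :=
  Set.range D.pos ∪ ⋃ e, D.arc e

/-- The outer face: the unbounded connected region of the complement of the drawing. -/
def outerFace {V : Type*} {G : SimpleGraph V} (D : OuterplaneDrawing G) : Set ℂ :=
  {z | z ∈ D.supportᶜ ∧ ¬ Bornology.IsBounded (connectedComponentIn D.supportᶜ z)}

/-- The edge `e` lies on the boundary of the outer face. -/
def OnOuterFace {V : Type*} {G : SimpleGraph V} (D : OuterplaneDrawing G) (e : G.edgeSet) : Prop :=
  D.arc e ⊆ frontier D.outerFace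

/-- `a`, `b`, `c` span an internal triangle: they are pairwise adjacent and none of the three edges
lies on the boundary of the outer face. (As all vertices lie on the bounding circle, every
triangle of `G` bounds an inner face; if `G` is maximal outerplanar, all inner faces are bounded by
triangles.) -/
def IsInternalTriangle {V : Type*} {G : SimpleGraph V} (D : OuterplaneDrawing G)
    (a b c : V) : Prop :=
  ∃ (hab : G.Adj a b) (hbc : G.Adj b c) (hca : G.Adj c a),
    ¬ D.OnOuterFace ⟨s(a, b), hab⟩ ∧ ¬ D.OnOuterFace ⟨s(b, c), hbc⟩ ∧
      ¬ D.OnOuterFace ⟨s(c, a), hca⟩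

/-- The drawing has no internal triangles. -/
def IsStriped {V : Type*} {G : SimpleGraph V} (D : OuterplaneDrawing G) : Prop :=
  ∀ a b c : V, ¬ D.IsInternalTriangle a b c

theorem support_subset {V : Type*} {G : SimpleGraph V} (D : OuterplaneDrawing G) :
    D.support ⊆ Metric.closedBall 0 1 := by
  rintro z (⟨v, rfl⟩ | hz)
  · simp [D.norm_pos v]
  · obtain ⟨e, he⟩ := Set.mem_iUnion.1 hz
    exact D.arc_subset e he

/-- In an outerplane drawing every vertex lies on the boundary of the outer face. -/
theorem pos_mem_frontier_outerFace {V : Type*} {G : SimpleGraph V} (D : OuterplaneDrawing G)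
    (v : V) : D.pos v ∈ frontier D.outerFace := by
  have hout : ∀ z : ℂ, 1 < ‖z‖ → z ∈ D.outerFace := by
    intro z hz
    have hsub : (fun t : ℝ => (t : ℂ) * z) '' Set.Ici 1 ⊆ D.supportᶜ := by
      rintro _ ⟨t, ht, rfl⟩ hmem
      have h1 := D.support_subset hmem
      have ht' : (1 : ℝ) ≤ t := ht
      rw [mem_closedBall_zero_iff, norm_mul, Complex.norm_real, Real.norm_eq_abs,
        abs_of_pos (by linarith)] at h1
      nlinarith
    have hzS : z ∈ (fun t : ℝ => (t : ℂ) * z) '' Set.Ici 1 := ⟨1, Set.self_mem_Ici, by simp⟩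
    refine ⟨hsub hzS, fun hb => ?_⟩
    have hconn : IsPreconnected ((fun t : ℝ => (t : ℂ) * z) '' Set.Ici 1) :=
      isPreconnected_Ici.image _ (by fun_prop)
    obtain ⟨C, hC⟩ := (hb.subset (hconn.subset_connectedComponentIn hzS hsub)).exists_norm_le
    have h2 := hC _ ⟨max 1 (C + 1), Set.mem_Ici.2 (le_max_left _ _), rfl⟩
    have h3 : 1 ≤ max 1 (C + 1) := le_max_left _ _
    have h4 : C + 1 ≤ max 1 (C + 1) := le_max_right _ _
    rw [norm_mul, Complex.norm_real, Real.norm_eq_abs, abs_of_pos (by linarith)] at h2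
    nlinarith
  have hnot : D.pos v ∉ D.outerFace := fun h => h.1 (Or.inl ⟨v, rfl⟩)
  refine ⟨?_, fun h => hnot (interior_subset h)⟩
  have hlim : Filter.Tendsto (fun t : ℝ => (t : ℂ) * D.pos v) (nhdsWithin 1 (Set.Ioi 1))
      (nhds (D.pos v)) := by
    have hc : Continuous (fun t : ℝ => (t : ℂ) * D.pos v) := by fun_prop
    have := (hc.tendsto 1).mono_left (nhdsWithin_le_nhds (s := Set.Ioi (1 : ℝ)))
    simpa using this
  refine mem_closure_of_tendsto hlim ?_
  filter_upwards [self_mem_nhdsWithin] with t ht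
  apply hout
  have ht' : (1 : ℝ) < t := ht
  rw [norm_mul, D.norm_pos v, mul_one, Complex.norm_real, Real.norm_eq_abs,
    abs_of_pos (by linarith)]
  exact ht'

end OuterplaneDrawing

/-- `G` is outerplanar: it has an outerplane drawing. -/
def IsOuterplanar {V : Type*} (G : SimpleGraph V) : Prop :=
  Nonempty (OuterplaneDrawing G)

/-- `G` is maximal outerplanar: it is outerplanar, and joining any two distinct non-adjacent
vertices by a new edge gives a graph that is not outerplanar. -/
def IsMaximalOuterplanar {V : Type*} (G : SimpleGraph V) : Prop :=
  IsOuterplanar G ∧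
    ∀ u v : V, u ≠ v → ¬ G.Adj u v → ¬ IsOuterplanar (G ⊔ SimpleGraph.edge u v)

/-! ### The extremal graphs

The vertices `p₁, …, p_k` of a path are indexed by `Fin k`, so `p_l` is the index of value
`l - 1`. -/

/-- The straight linear 2-tree: `v_i` and `v_j` are adjacent iff `0 < |i - j| ≤ 2`. -/
def straightLinearTwoTree (n : ℕ) : SimpleGraph (Fin n) :=
  SimpleGraph.fromRel fun i j => i.val < j.val ∧ j.val ≤ i.val + 2

/-- The fan `F_k`: the join of a single vertex `v = none` and the path `p_1 … p_k`
(its order is `k + 1`). -/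
def fan (k : ℕ) : SimpleGraph (Option (Fin k)) :=
  SimpleGraph.fromRel fun a b =>
    match a, b with
    | none, some _ => True
    | some i, some j => i.val + 1 = j.val
    | _, _ => False

/-- The quasi-fan `F(i; n)`: the fan `F_{n-2}` together with a new vertex `u = none` that is
joined to `p_i` and `p_{i+1}`. -/
def quasiFan (i n : ℕ) : SimpleGraph (Option (Option (Fin (n - 2)))) :=
  SimpleGraph.fromRel fun a b =>
    match a, b with
    | some a', some b' => (fan (n - 2)).Adj a' b'
    | none, some (some l) => l.val + 1 = i ∨ l.val + 1 = i + 1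
    | _, _ => False

/-- The vertices of two glued fans: `v`, the path vertices `p_1, …, p_k` of the first fan,
and the path vertices `u_1, …, u_m` of the second one (whose centre is one of the `p_l`). -/
inductive DoubleFanVertex (k m : ℕ) : Type
  | v : DoubleFanVertex k m
  | p (l : Fin k) : DoubleFanVertex k m
  | u (l : Fin m) : DoubleFanVertex k m

/-- The graph `DF^j(t; n)`: the fans `{v} ⊕ (p_1 … p_{3t})` and `{u} ⊕ (u_1 … u_{n-3t-1})`, glued
along `u = p_{3j-1}`. -/
def doubleFan (j t n : ℕ) : SimpleGraph (DoubleFanVertex (3 * t) (n - 3 * t - 1)) :=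
  SimpleGraph.fromRel fun a b =>
    match a, b with
    | .v, .p _ => True
    | .p l, .p l' => l.val + 1 = l'.val
    | .p l, .u _ => l.val + 2 = 3 * j
    | .u l, .u l' => l.val + 1 = l'.val
    | _, _ => False

/-- The graph `G_1(j)`: `DF^j(t; n)` with the additional edge `p_{3j-2} u_1`. -/
def doubleFanOne (j t n : ℕ) : SimpleGraph (DoubleFanVertex (3 * t) (n - 3 * t - 1)) :=
  doubleFan j t n ⊔ SimpleGraph.fromRel fun a b =>
    match a, b with
    | .p l, .u l' => l.val + 3 = 3 * j ∧ l'.val = 0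
    | _, _ => False

/-- The graph `G_2(j)`: `DF^j(t; n)` with the additional edge `p_{3j} u_{n-3t-1}`. -/
def doubleFanTwo (j t n : ℕ) : SimpleGraph (DoubleFanVertex (3 * t) (n - 3 * t - 1)) :=
  doubleFan j t n ⊔ SimpleGraph.fromRel fun a b =>
    match a, b with
    | .p l, .u l' => l.val + 1 = 3 * j ∧ l'.val + 1 = n - 3 * t - 1
    | _, _ => False

/-! ### Crossing arcs in a disc -/

/-! Topology serves only to replace the drawing by a combinatorial polygon. Number the vertices
cyclically by angle. Arcs in the disc with interlaced ends meet (`inter_nonempty_of_interlaced`, a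
winding argument), so no two edges are interlaced. Conversely, a graph without interlaced edges can
be drawn with straight chords, so maximality means that every missing chord is crossed by an edge.
The boundary cycle shields all other chords from the outer face (`not_onOuterFace`), so every
triangle has a side on that cycle. `IsStripedPolygon` records the outcome.

From any ear `p 1` the polygon can be labelled, up to reflection, so that a hub `p 0` spans a fan on
`p 1, …, p k` and `p k` is adjacent to `p (n - 1)` (`IsHubLabelling`). For `1 ≤ i ≤ k - 2`, geodesic
distances from `p i` to `p k` and beyond are those from the hub plus one.

Let `R` be a general position set with at least four vertices. It has no three vertices inducing a
connected subgraph, hence no three consecutive boundary vertices, and a stretch of length `L`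
carries at most `(2L + 2)/3` of its elements, fewer if an end pair is not full. If `R` misses two
ears, bridging them gives `3|R| ≤ 2n - 3`. Otherwise `R` contains an ear `p 1`, hence not the hub,
and the fan and the rest are counted separately. If `3|R| ≥ 2n - 2`, then either the graph is a fan
and `3|R| ≤ 2n`, or `3|R| = 2n - 2` and `n = k + 3` (a quasi-fan), or `3|R| = 2n - 2`, `3 ∣ k + 1`
and `p k` is the centre of a second fan (`card_of_mem`, `card_of_notMem`). Explicit sets show that
these graphs attain the bound.

For the value 3: a vertex with five neighbours yields four vertices in general position, so
otherwise the triangulation is a zigzag. In the straight linear 2-tree the distance is `⌈|i -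
j|/2⌉`, so three vertices are in general position only if both consecutive gaps are odd; four
vertices cannot satisfy this for every triple. -/

theorem exists_continuous_log {F : ℝ × ℝ → ℂ} (hF : Continuous F) (h0 : ∀ x, F x ≠ 0) :
    ∃ L : ℝ × ℝ → ℂ, Continuous L ∧ ∀ x, Complex.exp (L x) = F x := by
  obtain ⟨L, ⟨-, hL⟩, -⟩ := Complex.isCoveringMapOn_exp.existsUnique_continuousMap_lifts
    (A := ℝ × ℝ) ⟨F, hF⟩ (a₀ := 0) (Complex.exp_log (h0 0)) (fun x => h0 x)
  exact ⟨L, L.continuous, fun x => congrFun hL x⟩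

/-- Uniqueness of lifts through the covering `exp`: two continuous logarithms of the same function
on a line differ by a constant. -/
theorem eq_of_exp_eq_const {K : ℝ → ℂ} (hK : Continuous K)
    (h : ∀ t, Complex.exp (K t) = Complex.exp (K 0)) (t : ℝ) : K t = K 0 := by
  have := Complex.isCoveringMap_exp.eq_of_comp_eq (A := ℝ) hK (continuous_const (y := K 0))
    (by funext t; exact Subtype.ext (h t)) 0 rfl
  exact congrFun this t

/-- Factor `1 - e^{ix} = 2 sin(x/2) e^{i(x-π)/2}` with a positive modulus. This is the inscribed
angle theorem: seen from a point of the circle, an arc subtends half its angle. -/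
theorem arg_one_sub_exp {x : ℝ} (h0 : 0 < x) (h1 : x < 2 * Real.pi) :
    (1 - Complex.exp (x * Complex.I)).arg = (x - Real.pi) / 2 := by
  have hs : 0 < 2 * Real.sin (x / 2) := by
    have := Real.sin_pos_of_pos_of_lt_pi (x := x / 2) (by linarith) (by linarith)
    linarith
  have : 1 - Complex.exp (x * Complex.I) = ((2 * Real.sin (x / 2) : ℝ) : ℂ) *
      (Complex.cos (((x - Real.pi) / 2 : ℝ) : ℂ) +
        Complex.sin (((x - Real.pi) / 2 : ℝ) : ℂ) * Complex.I) := by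
    have e1 : Real.cos ((x - Real.pi) / 2) = Real.sin (x / 2) := by
      rw [← Real.cos_pi_div_two_sub, ← Real.cos_neg]; congr 1; ring
    have e2 : Real.sin ((x - Real.pi) / 2) = - Real.cos (x / 2) := by
      rw [← Real.sin_pi_div_two_sub, ← Real.sin_neg]; congr 1; ring
    have e3 : Real.cos x = 1 - 2 * Real.sin (x / 2) ^ 2 := by
      have := Real.cos_sq' (x / 2)
      have h2 := Real.cos_two_mul (x / 2)
      rw [show 2 * (x / 2) = x by ring] at h2
      linarith
    have e4 : Real.sin x = 2 * Real.sin (x / 2) * Real.cos (x / 2) := by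
      rw [← Real.sin_two_mul]; congr 1; ring
    rw [Complex.exp_mul_I, ← Complex.ofReal_cos, ← Complex.ofReal_sin, ← Complex.ofReal_cos,
      ← Complex.ofReal_sin, e1, e2, e3, e4]
    push_cast
    ring
  rw [this, Complex.arg_mul_cos_add_sin_mul_I hs ⟨by linarith, by linarith⟩]

theorem one_sub_mem_slitPlane {z : ℂ} (hz : ‖z‖ ≤ 1) (h1 : z ≠ 1) : 1 - z ∈ Complex.slitPlane := by
  refine Or.inl ?_
  have hre : z.re ≤ 1 := (Complex.re_le_norm z).trans hz
  rcases hre.lt_or_eq with h | h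
  · simpa using h
  · exfalso
    apply h1
    have h2 : z.re * z.re + z.im * z.im ≤ 1 := by
      have := Complex.sq_norm z
      rw [Complex.normSq_apply] at this
      rw [← this]
      exact pow_le_one₀ (norm_nonneg z) hz
    rw [h] at h2
    have h3 : z.im = 0 := by nlinarith
    exact Complex.ext (by simpa using h) (by simpa using h3)

/-- Along a path in the closed disc avoiding the point of angle `α` of the circle, a continuous
logarithm of the difference changes by half of the angle swept. -/
theorem im_log_sub {ψ L : ℝ → ℂ} {c : ℂ} {α x₀ x₁ : ℝ} (hψ : Continuous ψ) (hL : Continuous L)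
    (hb : ∀ t, ‖ψ t‖ ≤ 1) (hne : ∀ t, ψ t ≠ Complex.exp (α * Complex.I))
    (hexp : ∀ t, Complex.exp (L t) = c * (Complex.exp (α * Complex.I) - ψ t))
    (h₀ : ψ 0 = Complex.exp ((α + x₀ : ℝ) * Complex.I))
    (h₁ : ψ 1 = Complex.exp ((α + x₁ : ℝ) * Complex.I))
    (hx₀ : 0 < x₀) (hx₀' : x₀ < 2 * Real.pi) (hx₁ : 0 < x₁) (hx₁' : x₁ < 2 * Real.pi) :
    (L 1).im - (L 0).im = (x₁ - x₀) / 2 := by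
  set e := Complex.exp (-(α * Complex.I)) with he
  have hee : Complex.exp (α * Complex.I) * e = 1 := by
    rw [he, ← Complex.exp_add]; simp
  have hne' : ∀ t, ψ t * e ≠ 1 := by
    intro t ht
    apply hne t
    calc ψ t = ψ t * (Complex.exp (α * Complex.I) * e) := by rw [hee, mul_one]
      _ = (ψ t * e) * Complex.exp (α * Complex.I) := by ring
      _ = _ := by rw [ht, one_mul]
  have hen : ‖e‖ = 1 := by
    rw [he, ← neg_mul, ← Complex.ofReal_neg, Complex.norm_exp_ofReal_mul_I]
  have hslit : ∀ t, 1 - ψ t * e ∈ Complex.slitPlane := fun t =>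
    one_sub_mem_slitPlane (by rw [norm_mul, hen, mul_one]; exact hb t) (hne' t)
  -- Rotated by `-α`, the difference stays in the slit plane, so the principal logarithm is
  -- continuous along the path and `L` differs from it by a constant.
  have hK : Continuous fun t => L t - Complex.log (1 - ψ t * e) :=
    hL.sub (Continuous.clog (by fun_prop) hslit)
  have hKe : ∀ t, Complex.exp (L t - Complex.log (1 - ψ t * e)) =
      c * Complex.exp (α * Complex.I) := by
    intro t
    have h0 : 1 - ψ t * e ≠ 0 := Complex.slitPlane_ne_zero (hslit t)
    rw [Complex.exp_sub, Complex.exp_log h0, hexp, div_eq_iff h0]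
    linear_combination (c * ψ t) * hee
  have key := eq_of_exp_eq_const hK (fun t => by rw [hKe, hKe]) 1
  have arg' : ∀ x : ℝ, Complex.exp ((α + x : ℝ) * Complex.I) * e = Complex.exp (x * Complex.I) := by
    intro x
    rw [he, ← Complex.exp_add]; congr 1; push_cast; ring
  have := congrArg Complex.im key
  simp only [Complex.sub_im, Complex.log_im, h₀, h₁, arg', arg_one_sub_exp hx₀ hx₀',
    arg_one_sub_exp hx₁ hx₁'] at this
  linarith

/-- Two paths in the closed disc joining interlaced pairs of points of the circle meet. -/
theorem inter_nonempty_of_interlaced {S T : Set ℂ} {α β γ δ : ℝ}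
    (hS : S ⊆ Metric.closedBall 0 1) (hT : T ⊆ Metric.closedBall 0 1)
    (hαγ : α < γ) (hγβ : γ < β) (hβδ : β < δ) (hδα : δ < α + 2 * Real.pi)
    (hSj : JoinedIn S (Complex.exp (α * Complex.I)) (Complex.exp (β * Complex.I)))
    (hTj : JoinedIn T (Complex.exp (γ * Complex.I)) (Complex.exp (δ * Complex.I))) :
    (S ∩ T).Nonempty := by
  by_contra hem
  obtain ⟨P, hP⟩ := hSj
  obtain ⟨Q, hQ⟩ := hTj
  set f : ℝ → ℂ := ⇑P.extend with hf
  set g : ℝ → ℂ := ⇑Q.extend with hg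
  have hfc : Continuous f := P.continuous_extend
  have hgc : Continuous g := Q.continuous_extend
  have hfS : ∀ s, f s ∈ S := fun s => hP (Set.projIcc 0 1 zero_le_one s)
  have hgT : ∀ s, g s ∈ T := fun s => hQ (Set.projIcc 0 1 zero_le_one s)
  have hfg : ∀ s t, f s ≠ g t := fun s t h => hem ⟨f s, hfS s, h ▸ hgT t⟩
  have hfn : ∀ s, ‖f s‖ ≤ 1 := fun s => by simpa using hS (hfS s)
  have hgn : ∀ s, ‖g s‖ ≤ 1 := fun s => by simpa using hT (hgT s)
  have f0 : f 0 = Complex.exp (α * Complex.I) := by simp [hf]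
  have f1 : f 1 = Complex.exp (β * Complex.I) := by simp [hf]
  have g0 : g 0 = Complex.exp (γ * Complex.I) := by simp [hg]
  have g1 : g 1 = Complex.exp (δ * Complex.I) := by simp [hg]
  -- Disjoint paths make `f s - g t` nowhere zero, so it has a single-valued logarithm, whose total
  -- change around the unit square is zero.
  obtain ⟨L, hL, hexp⟩ := exists_continuous_log (F := fun x => f x.1 - g x.2) (by fun_prop)
    (fun x => sub_ne_zero.2 (hfg _ _))
  have per : ∀ x : ℝ, Complex.exp ((x + 2 * Real.pi : ℝ) * Complex.I) =
      Complex.exp (x * Complex.I) := by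
    intro x
    rw [Complex.exp_eq_exp_iff_exists_int]
    exact ⟨1, by push_cast; ring⟩
  have A := im_log_sub (ψ := g) (L := fun t => L (0, t)) (c := 1) (α := α) (x₀ := γ - α)
    (x₁ := δ - α) hgc (by fun_prop) hgn (fun t => f0 ▸ (hfg 0 t).symm)
    (fun t => by rw [hexp, f0, one_mul]) (by rw [g0]; congr 3; ring) (by rw [g1]; congr 3; ring)
    (by linarith) (by linarith) (by linarith) (by linarith)
  have B := im_log_sub (ψ := g) (L := fun t => L (1, t)) (c := 1) (α := β)
    (x₀ := γ - β + 2 * Real.pi)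
    (x₁ := δ - β) hgc (by fun_prop) hgn (fun t => f1 ▸ (hfg 1 t).symm)
    (fun t => by rw [hexp, f1, one_mul]) (by rw [g0, ← per]; congr 3; ring)
    (by rw [g1]; congr 3; ring)
    (by linarith) (by linarith) (by linarith) (by linarith)
  have C := im_log_sub (ψ := f) (L := fun t => L (t, 0)) (c := -1) (α := γ)
    (x₀ := α - γ + 2 * Real.pi)
    (x₁ := β - γ) hfc (by fun_prop) hfn (fun t => g0 ▸ hfg t 0)
    (fun t => by rw [hexp, g0]; ring) (by rw [f0, ← per]; congr 3; ring)
    (by rw [f1]; congr 3; ring)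
    (by linarith) (by linarith) (by linarith) (by linarith)
  have D := im_log_sub (ψ := f) (L := fun t => L (t, 1)) (c := -1) (α := δ)
    (x₀ := α - δ + 2 * Real.pi)
    (x₁ := β - δ + 2 * Real.pi) hfc (by fun_prop) hfn (fun t => g1 ▸ hfg t 1)
    (fun t => by rw [hexp, g1]; ring) (by rw [f0, ← per]; congr 3; ring)
    (by rw [f1, ← per]; congr 3; ring)
    (by linarith) (by linarith) (by linarith) (by linarith)
  -- Write `A`, `B`, `C`, `D` for the changes of `Im L` along the four sides. Telescoping gives `A +
  -- D = B + C`, whereas the half-angles give `A + D = B + C + 2π`.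
  have := Real.pi_pos
  linarith

/-! ### Cyclic labelling of the vertices of an outerplane graph -/

/-- The vertices are numbered cyclically by `p` in the order of their angles `Θ` on the unit
circle. -/
structure CircularLabelling {V : Type*} (pos : V → ℂ) (n : ℤ) (p : ℤ → V) (Θ : ℤ → ℝ) :
    Prop where
  pos_eq : ∀ i, pos (p i) = Complex.exp (Θ i * Complex.I)
  strictMono : StrictMono Θ
  add_period : ∀ i, Θ (i + n) = Θ i + 2 * Real.pi
  surjective : Function.Surjective p
  eq_iff : ∀ i j, p i = p j ↔ n ∣ j - i

theorem exists_circularLabelling {V : Type*} [Fintype V] {pos : V → ℂ}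
    (hinj : Function.Injective pos) (hnorm : ∀ v, ‖pos v‖ = 1) {n : ℕ}
    (hcard : Fintype.card V = n) (hn : 0 < n) :
    ∃ (p : ℤ → V) (Θ : ℤ → ℝ), CircularLabelling pos n p Θ := by
  classical
  set θ : V → ℝ := fun v => (pos v).arg with hθ
  have hpos : ∀ v, pos v = Complex.exp (θ v * Complex.I) := by
    intro v
    have := Complex.norm_mul_exp_arg_mul_I (pos v)
    rw [hnorm v, Complex.ofReal_one, one_mul] at this
    exact this.symm
  have hθinj : Function.Injective θ := fun a b hab => hinj (by rw [hpos a, hpos b, hab])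
  have hc : (Finset.univ.image θ).card = n := by
    rw [Finset.card_image_of_injective _ hθinj, Finset.card_univ, hcard]
  set t := (Finset.univ.image θ).orderEmbOfFin hc with ht
  have htm : ∀ i, ∃ v, θ v = t i := by
    intro i
    have := (Finset.univ.image θ).orderEmbOfFin_mem hc i
    rw [Finset.mem_image] at this
    obtain ⟨v, -, hv⟩ := this
    exact ⟨v, hv⟩
  choose q hq using htm
  have hn' : (0 : ℤ) < n := by exact_mod_cast hn
  have hlt : ∀ i : ℤ, (i % n).toNat < n := by
    intro i
    have h1 := Int.emod_nonneg i hn'.ne'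
    have h2 := Int.emod_lt_of_pos i hn'
    omega
  have hqinj : Function.Injective q := fun a b hab => t.injective (by rw [← hq, ← hq, hab])
  have hqsurj : Function.Surjective q :=
    ((Fintype.bijective_iff_injective_and_card q).2 ⟨hqinj, by simp [hcard]⟩).2
  -- The residue of `i` selects the vertex; the floor `i / n` counts full turns, each adding `2π`.
  refine ⟨fun i => q ⟨(i % n).toNat, hlt i⟩,
    fun i => t ⟨(i % n).toNat, hlt i⟩ + 2 * Real.pi * ((i / n : ℤ) : ℝ), ?_, ?_, ?_, ?_, ?_⟩
  · intro i
    rw [hpos, hq, Complex.exp_eq_exp_iff_exists_int]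
    exact ⟨-(i / n), by push_cast; ring⟩
  · refine strictMono_int_of_lt_succ fun i => ?_
    have hb : ∀ j, -Real.pi < t j ∧ t j ≤ Real.pi := fun j => by
      rw [← hq]; exact ⟨Complex.neg_pi_lt_arg _, Complex.arg_le_pi _⟩
    have h1 := Int.emod_nonneg i hn'.ne'
    have h2 := Int.emod_lt_of_pos i hn'
    have h3 := Int.emod_add_mul_ediv i n
    by_cases h : i % n + 1 < n
    · have e1 : (i + 1) / n = i / n ∧ (i + 1) % n = i % n + 1 :=
        (Int.ediv_emod_unique hn').2 ⟨by linarith, by omega, h⟩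
      rw [e1.1]
      have : t ⟨(i % n).toNat, hlt i⟩ < t ⟨((i + 1) % n).toNat, hlt (i + 1)⟩ := by
        apply t.strictMono
        rw [Fin.mk_lt_mk, e1.2]
        omega
      linarith
    · have e1 : (i + 1) / n = i / n + 1 ∧ (i + 1) % n = 0 :=
        (Int.ediv_emod_unique hn').2 ⟨by rw [mul_add]; linarith [show i % n + 1 = n by omega],
          le_rfl, hn'⟩
      rw [e1.1]
      push_cast
      have := (hb ⟨(i % n).toNat, hlt i⟩).2
      have := (hb ⟨((i + 1) % n).toNat, hlt (i + 1)⟩).1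
      linarith
  · intro i
    simp only [Int.add_emod_right, Int.add_ediv_of_dvd_right (dvd_refl (n : ℤ)),
      Int.ediv_self hn'.ne']
    push_cast
    ring
  · intro v
    obtain ⟨j, rfl⟩ := hqsurj v
    refine ⟨(j.val : ℤ), ?_⟩
    refine congrArg q (Fin.ext ?_)
    simp only
    rw [Int.emod_eq_of_lt (by omega) (by have := j.2; omega)]
    simp
  · intro i j
    rw [hqinj.eq_iff, Fin.mk.injEq, ← Int.emod_emod_of_dvd i (dvd_refl (n : ℤ)),
      ← Int.modEq_iff_dvd, Int.ModEq]
    have h1 := Int.emod_nonneg i hn'.ne'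
    have h2 := Int.emod_nonneg j hn'.ne'
    simp only [Int.emod_emod_of_dvd _ (dvd_refl (n : ℤ))]
    omega

namespace CircularLabelling

variable {V : Type*} {pos : V → ℂ} {n : ℤ} {p : ℤ → V} {Θ : ℤ → ℝ}

theorem ne_of_lt (h : CircularLabelling pos n p Θ) {i j : ℤ} (h1 : i < j) (h2 : j < i + n) :
    p i ≠ p j := by
  intro he
  have := Int.eq_zero_of_abs_lt_dvd ((h.eq_iff i j).1 he) (by rw [abs_lt]; omega)
  omega

theorem apply_add_mul (h : CircularLabelling pos n p Θ) (i k : ℤ) : p (i + n * k) = p i :=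
  ((h.eq_iff _ _).2 ⟨-k, by ring⟩)

/-- Every vertex has a label in a given window of length `n`. -/
theorem exists_label (h : CircularLabelling pos n p Θ) (hn : 0 < n) (a : ℤ) (v : V) :
    ∃ i, a ≤ i ∧ i < a + n ∧ p i = v := by
  obtain ⟨j, rfl⟩ := h.surjective v
  refine ⟨a + (j - a) % n, ?_, ?_, (h.eq_iff _ _).2 ?_⟩
  · have := Int.emod_nonneg (j - a) hn.ne'; omega
  · have := Int.emod_lt_of_pos (j - a) hn; omega
  · exact ⟨(j - a) / n, by have := Int.emod_add_mul_ediv (j - a) n; linarith⟩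

theorem lt_add_two_pi (h : CircularLabelling pos n p Θ) {i j : ℤ} (hij : j < i + n) :
    Θ j < Θ i + 2 * Real.pi := by
  rw [← h.add_period]; exact h.strictMono hij

end CircularLabelling

theorem OuterplaneDrawing.joinedIn_arc {V : Type*} {G : SimpleGraph V} (D : OuterplaneDrawing G)
    {u v : V} (h : G.Adj u v) : JoinedIn (D.arc ⟨s(u, v), h⟩) (D.pos u) (D.pos v) := by
  obtain ⟨γ, -, hγ⟩ := D.arc_isArc u v h
  exact ⟨γ, fun t => hγ ▸ ⟨t, rfl⟩⟩

/-- The two arcs would meet. They are different arcs, so the common point is a vertex and an end of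
both edges, but the four ends are distinct. -/
theorem OuterplaneDrawing.not_adj_of_interlaced {V : Type*} {G : SimpleGraph V}
    (D : OuterplaneDrawing G) {n : ℤ} {p : ℤ → V} {Θ : ℤ → ℝ}
    (h : CircularLabelling D.pos n p Θ) {a b c d : ℤ} (hac : a < c) (hcb : c < b) (hbd : b < d)
    (hda : d < a + n) (hab : G.Adj (p a) (p b)) : ¬ G.Adj (p c) (p d) := by
  intro hcd
  have j1 := D.joinedIn_arc hab
  have j2 := D.joinedIn_arc hcd
  rw [h.pos_eq, h.pos_eq] at j1 j2
  obtain ⟨z, hz⟩ := inter_nonempty_of_interlaced (D.arc_subset _) (D.arc_subset _)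
    (h.strictMono hac) (h.strictMono hcb) (h.strictMono hbd) (h.lt_add_two_pi hda) j1 j2
  have n1 := h.ne_of_lt hac (by omega)
  have n2 := h.ne_of_lt hcb (by omega)
  have n3 := h.ne_of_lt hbd (by omega)
  have n4 := h.ne_of_lt (hac.trans (hcb.trans hbd)) hda
  obtain ⟨w, rfl⟩ := D.arc_inter_arc ⟨s(p a, p b), hab⟩ ⟨s(p c, p d), hcd⟩ (by
    intro he
    have := congrArg Subtype.val he
    simp only [Sym2.eq_iff] at this
    rcases this with ⟨h1, -⟩ | ⟨h1, -⟩
    · exact n1 h1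
    · exact n4 h1) hz
  have m1 := D.mem_of_pos_mem_arc _ _ hz.1
  have m2 := D.mem_of_pos_mem_arc _ _ hz.2
  simp only [Sym2.mem_iff] at m1 m2
  rcases m1 with rfl | rfl <;> rcases m2 with h' | h'
  · exact n1 h'
  · exact n4 h'
  · exact n2 h'.symm
  · exact n3 h'

/-! ### Straight-line drawings -/

/-- The signed distance from the line through the points of angles `α` and `β` of the unit
circle. -/
noncomputable def chordSide (α β : ℝ) (z : ℂ) : ℝ :=
  Real.cos ((β - α) / 2) - (z * Complex.exp ((-((α + β) / 2) : ℝ) * Complex.I)).re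

/-- The product form exhibits the sign on the circle: it changes exactly at the two ends of the
chord. -/
theorem chordSide_exp (α β φ : ℝ) : chordSide α β (Complex.exp (φ * Complex.I)) =
    2 * (Real.sin ((φ - α) / 2) * Real.sin ((φ - β) / 2)) := by
  rw [chordSide, ← Complex.exp_add, ← add_mul, ← Complex.ofReal_add, Complex.exp_ofReal_mul_I_re]
  have h1 : (β - α) / 2 = (φ - α) / 2 - (φ - β) / 2 := by ring
  have h2 : φ + -((α + β) / 2) = (φ - α) / 2 + (φ - β) / 2 := by ring
  rw [h1, h2, Real.cos_add, Real.cos_sub]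
  ring

theorem chordSide_combo (α β : ℝ) {x y : ℝ} (hxy : x + y = 1) (c d : ℂ) :
    chordSide α β (x • c + y • d) = x * chordSide α β c + y * chordSide α β d := by
  simp only [chordSide, Complex.real_smul, add_mul, Complex.add_re, mul_assoc,
    Complex.re_ofReal_mul]
  linear_combination (-Real.cos ((β - α) / 2)) * hxy

/-- `chordSide α β` is affine and vanishes on the first segment. On the second it interpolates two
values of the same weak sign, not both zero, so it can vanish only at an end. -/
theorem eq_or_eq_of_mem_segments {α β : ℝ} {z c d : ℂ}
    (hz : z ∈ segment ℝ (Complex.exp (α * Complex.I)) (Complex.exp (β * Complex.I)))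
    (hz' : z ∈ segment ℝ c d) (h0 : ¬ (chordSide α β c = 0 ∧ chordSide α β d = 0))
    (hside : (0 ≤ chordSide α β c ∧ 0 ≤ chordSide α β d) ∨
      (chordSide α β c ≤ 0 ∧ chordSide α β d ≤ 0)) : z = c ∨ z = d := by
  obtain ⟨x, y, hx, hy, hxy, rfl⟩ := hz
  obtain ⟨x', y', hx', hy', hxy', he⟩ := hz'
  have h1 := chordSide_combo α β hxy (Complex.exp (α * Complex.I)) (Complex.exp (β * Complex.I))
  rw [chordSide_exp, chordSide_exp, ← he, chordSide_combo α β hxy'] at h1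
  simp only [sub_self, zero_div, Real.sin_zero, zero_mul, mul_zero, add_zero] at h1
  rw [← he]
  have h2 : x' * chordSide α β c = 0 ∧ y' * chordSide α β d = 0 := by
    rcases hside with ⟨h2, h3⟩ | ⟨h2, h3⟩
    · have := mul_nonneg hx' h2
      have := mul_nonneg hy' h3
      constructor <;> linarith
    · have := mul_nonneg hx' (neg_nonneg.2 h2)
      have := mul_nonneg hy' (neg_nonneg.2 h3)
      constructor <;> linarith
  rcases mul_eq_zero.1 h2.1 with h | h
  · right
    have : y' = 1 := by linarith
    simp [h, this]
  · rcases mul_eq_zero.1 h2.2 with h' | h'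
    · left
      have : x' = 1 := by linarith
      simp [h', this]
    · exact absurd ⟨h, h'⟩ h0

namespace CircularLabelling

variable {V : Type*} {pos : V → ℂ} {n : ℤ} {p : ℤ → V} {Θ : ℤ → ℝ}

theorem chordSide_neg (h : CircularLabelling pos n p Θ) {a b c : ℤ} (hac : a < c) (hcb : c < b)
    (hb : b < a + n) : chordSide (Θ a) (Θ b) (pos (p c)) < 0 := by
  rw [h.pos_eq, chordSide_exp]
  have h1 := h.strictMono hac
  have h2 := h.strictMono hcb
  have h3 := h.lt_add_two_pi hb
  have s1 : 0 < Real.sin ((Θ c - Θ a) / 2) :=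
    Real.sin_pos_of_pos_of_lt_pi (by linarith) (by linarith)
  have s2 : Real.sin ((Θ c - Θ b) / 2) < 0 :=
    Real.sin_neg_of_neg_of_neg_pi_lt (by linarith) (by linarith)
  nlinarith

theorem chordSide_pos (h : CircularLabelling pos n p Θ) {a b c : ℤ} (hab : a < b) (hbc : b < c)
    (hc : c < a + n) : 0 < chordSide (Θ a) (Θ b) (pos (p c)) := by
  rw [h.pos_eq, chordSide_exp]
  have h1 := h.strictMono hab
  have h2 := h.strictMono hbc
  have h3 := h.lt_add_two_pi hc
  have s1 : 0 < Real.sin ((Θ c - Θ a) / 2) :=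
    Real.sin_pos_of_pos_of_lt_pi (by linarith) (by linarith)
  have s2 : 0 < Real.sin ((Θ c - Θ b) / 2) :=
    Real.sin_pos_of_pos_of_lt_pi (by linarith) (by linarith)
  positivity

theorem chordSide_left (h : CircularLabelling pos n p Θ) (a b : ℤ) :
    chordSide (Θ a) (Θ b) (pos (p a)) = 0 := by
  simp [h.pos_eq, chordSide_exp]

theorem chordSide_right (h : CircularLabelling pos n p Θ) (a b : ℤ) :
    chordSide (Θ a) (Θ b) (pos (p b)) = 0 := by
  simp [h.pos_eq, chordSide_exp]

theorem mem_range_of_mem_segments (h : CircularLabelling pos n p Θ) {G : SimpleGraph V}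
    (hnc : ∀ a b c d, a < c → c < b → b < d → d < a + n → G.Adj (p a) (p b) →
      ¬ G.Adj (p c) (p d)) {a b c d : ℤ} (hab : a < b) (hb : b < a + n) (hac : a ≤ c)
    (hcd : c < d) (hd : d < a + n) (hadj : G.Adj (p a) (p b)) (hadj' : G.Adj (p c) (p d))
    (hne : ¬ (c = a ∧ d = b)) {z : ℂ} (hz : z ∈ segment ℝ (pos (p a)) (pos (p b)))
    (hz' : z ∈ segment ℝ (pos (p c)) (pos (p d))) : z ∈ Set.range pos := by
  rw [h.pos_eq a, h.pos_eq b] at hz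
  suffices z = pos (p c) ∨ z = pos (p d) by
    rcases this with rfl | rfl <;> exact ⟨_, rfl⟩
  have key : ∀ e, a ≤ e → e < a + n → (chordSide (Θ a) (Θ b) (pos (p e)) = 0 ↔ e = a ∨ e = b) ∧
      (e ≤ b → chordSide (Θ a) (Θ b) (pos (p e)) ≤ 0) ∧
      (b ≤ e ∨ e = a → 0 ≤ chordSide (Θ a) (Θ b) (pos (p e))) := by
    intro e he he'
    rcases lt_trichotomy e b with h1 | rfl | h1
    · rcases he.eq_or_lt with rfl | h2
      · simp [h.chordSide_left]
      · have := h.chordSide_neg h2 h1 hb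
        refine ⟨?_, fun _ => this.le, fun _ => by omega⟩
        simp [this.ne, h1.ne, h2.ne']
    · simp [h.chordSide_right]
    · have := h.chordSide_pos hab h1 he'
      refine ⟨?_, fun _ => by omega, fun _ => this.le⟩
      simp [this.ne', h1.ne', (hab.trans h1).ne']
  have kc := key c hac (by omega)
  have kd := key d (by omega) hd
  refine eq_or_eq_of_mem_segments hz hz' ?_ ?_
  · rw [kc.1, kd.1]
    omega
  · by_cases h1 : d ≤ b
    · exact Or.inr ⟨kc.2.1 (by omega), kd.2.1 h1⟩
    · left
      refine ⟨kc.2.2 ?_, kd.2.2 (by omega)⟩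
      by_contra h2
      exact hnc a b c d (by omega) (by omega) (by omega) hd hadj hadj'

/-- The converse of `not_adj_of_interlaced`, realised by straight chords; it is what turns
maximality into a statement about crossings. -/
theorem isOuterplanar (h : CircularLabelling pos n p Θ) (hn : 0 < n)
    (hinj : Function.Injective pos) (hnorm : ∀ v, ‖pos v‖ = 1) {G : SimpleGraph V}
    (hnc : ∀ a b c d, a < c → c < b → b < d → d < a + n → G.Adj (p a) (p b) →
      ¬ G.Adj (p c) (p d)) : IsOuterplanar G := by
  have hset : ∀ u v : V, convexHull ℝ (pos '' {w | w ∈ s(u, v)}) =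
      segment ℝ (pos u) (pos v) := by
    intro u v
    rw [← convexHull_pair, ← Set.image_pair]
    congr 2
    ext w
    simp
  have hball : ∀ v, pos v ∈ Metric.closedBall (0 : ℂ) 1 := fun v => by simp [hnorm v]
  -- A convex hull of the set of ends is defined on unordered pairs, so no orientation of the edge
  -- has to be chosen.
  refine ⟨⟨pos, fun e => convexHull ℝ (pos '' {w | w ∈ e.1}), hinj, hnorm, ?_, ?_, ?_, ?_⟩⟩
  · intro u v huv
    refine ⟨⟨⟨fun t => AffineMap.lineMap (pos u) (pos v) (t : ℝ), ?_⟩, by simp, by simp⟩, ?_, ?_⟩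
    · exact AffineMap.lineMap_continuous.comp continuous_subtype_val
    · intro s t hst
      have := AffineMap.lineMap_injective ℝ (hinj.ne huv.ne) hst
      exact Subtype.ext this
    · simp only [hset]
      rw [segment_eq_image_lineMap]
      ext z
      constructor
      · rintro ⟨t, rfl⟩
        exact ⟨t, t.2, rfl⟩
      · rintro ⟨t, ht, rfl⟩
        exact ⟨⟨t, ht⟩, rfl⟩
  · intro e
    refine convexHull_min ?_ (convex_closedBall _ _)
    rintro _ ⟨w, -, rfl⟩
    exact hball w
  · rintro ⟨e, he⟩ w hw
    induction e with | _ u v => ?_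
    simp only [hset] at hw
    simp only [Sym2.mem_iff]
    by_contra! hne
    -- Strict convexity: the open segment lies in the open disc, while vertices have norm 1.
    have h1 := mem_openSegment_of_ne_left_right (hinj.ne hne.1.symm) (hinj.ne hne.2.symm) hw
    have h2 := openSegment_subset_ball_of_ne (hball u) (hball v)
      (hinj.ne (G.ne_of_adj he)) h1
    simp [hnorm w] at h2
  · rintro ⟨e, he⟩ ⟨f, hf⟩ hne z ⟨hz, hz'⟩
    induction e with | _ u v => ?_
    induction f with | _ x y => ?_
    simp only [hset] at hz hz'
    have he' : G.Adj u v := he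
    have hf' : G.Adj x y := hf
    obtain ⟨a, -, -, rfl⟩ := h.exists_label hn 0 u
    obtain ⟨b, h1, h2, rfl⟩ := h.exists_label hn a v
    have hab : a ≠ b := by rintro rfl; exact he'.ne rfl
    obtain ⟨c, h3, h4, rfl⟩ := h.exists_label hn a x
    obtain ⟨d, h5, h6, rfl⟩ := h.exists_label hn a y
    have hcd : c ≠ d := by rintro rfl; exact hf'.ne rfl
    rcases hcd.lt_or_gt with h7 | h7
    · refine h.mem_range_of_mem_segments hnc (by omega) h2 h3 h7 h6 he' hf' ?_ hz hz'
      rintro ⟨rfl, rfl⟩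
      exact hne rfl
    · refine h.mem_range_of_mem_segments hnc (by omega) h2 h5 h7 h4 he' hf'.symm ?_ hz
        (by rw [segment_symm]; exact hz')
      rintro ⟨rfl, rfl⟩
      exact hne (Subtype.ext Sym2.eq_swap)

end CircularLabelling

/-! ### Chords are not on the outer face -/

theorem joinedIn_image_Icc {f : ℝ → ℂ} {S : Set ℂ} {a b : ℝ} (hab : a ≤ b)
    (hf : ContinuousOn f (Set.Icc a b)) (hS : ∀ t ∈ Set.Icc a b, f t ∈ S) :
    JoinedIn S (f a) (f b) := by
  have h1 : IsPathConnected (Set.Icc a b) :=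
    (convex_Icc a b).isPathConnected (Set.nonempty_Icc.2 hab)
  refine ((h1.image' hf).joinedIn _ ⟨a, Set.left_mem_Icc.2 hab, rfl⟩ _
    ⟨b, Set.right_mem_Icc.2 hab, rfl⟩).mono ?_
  rintro _ ⟨t, ht, rfl⟩
  exact hS t ht

/-- A path that starts inside the unit disc and ends outside has an initial part inside the closed
disc that ends on the circle. -/
theorem exists_joinedIn_sphere {S : Set ℂ} {q z : ℂ} (h : JoinedIn S q z) (hq : ‖q‖ ≤ 1)
    (hz : 1 < ‖z‖) : ∃ w, ‖w‖ = 1 ∧ JoinedIn (S ∩ Metric.closedBall 0 1) q w := by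
  obtain ⟨P, hP⟩ := h
  set f : ℝ → ℂ := ⇑P.extend with hf
  have hfc : Continuous f := P.continuous_extend
  have hfS : ∀ s, f s ∈ S := fun s => hP (Set.projIcc 0 1 zero_le_one s)
  have f0 : f 0 = q := by simp [hf]
  have f1 : f 1 = z := by simp [hf]
  set A : Set ℝ := Set.Icc 0 1 ∩ {t | 1 ≤ ‖f t‖} with hA
  have hAc : IsClosed A :=
    isClosed_Icc.inter (isClosed_le continuous_const hfc.norm)
  have hAne : A.Nonempty := ⟨1, ⟨zero_le_one, le_rfl⟩, by
    simp only [Set.mem_ofPred_eq, f1]; exact hz.le⟩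
  have hAb : BddBelow A := ⟨0, fun t ht => ht.1.1⟩
  have hmem := hAc.csInf_mem hAne hAb
  set t₀ := sInf A with ht₀
  have hlt : ∀ t, 0 ≤ t → t < t₀ → ‖f t‖ ≤ 1 := by
    intro t h0 h1
    by_contra! h2
    exact absurd (csInf_le hAb ⟨⟨h0, h1.le.trans hmem.1.2⟩, h2.le⟩) (not_le.2 h1)
  have hle : ‖f t₀‖ ≤ 1 := by
    rcases hmem.1.1.eq_or_lt with h0 | h0
    · rw [← h0, f0]; exact hq
    · have hcl : IsClosed {t | ‖f t‖ ≤ 1} := isClosed_le hfc.norm continuous_const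
      have : t₀ ∈ closure (Set.Ico 0 t₀) := by
        rw [closure_Ico h0.ne]; exact Set.right_mem_Icc.2 h0.le
      exact closure_minimal (fun t ht => hlt t ht.1 ht.2) hcl this
  refine ⟨f t₀, le_antisymm hle hmem.2, ?_⟩
  rw [← f0]
  refine joinedIn_image_Icc hmem.1.1 hfc.continuousOn fun t ht => ⟨hfS t, ?_⟩
  rw [mem_closedBall_zero_iff]
  rcases ht.2.lt_or_eq with h1 | rfl
  · exact hlt t ht.1 h1
  · exact hle

namespace CircularLabelling

variable {V : Type*} {pos : V → ℂ} {n : ℤ} {p : ℤ → V} {Θ : ℤ → ℝ}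

theorem succ_eq (h : CircularLabelling pos n p Θ) {i j : ℤ} (hij : p i = p j) :
    p (i + 1) = p (j + 1) := by
  rw [h.eq_iff] at hij ⊢
  simpa using hij

/-- A point of the circle that is not a vertex lies between two consecutive vertices. -/
theorem exists_between (h : CircularLabelling pos n p Θ) {w : ℂ} (hw : ‖w‖ = 1)
    (hne : w ∉ Set.range pos) : ∃ (i : ℤ) (φ : ℝ), w = Complex.exp (φ * Complex.I) ∧
      Θ i < φ ∧ φ < Θ (i + 1) := by
  have hwe : w = Complex.exp (w.arg * Complex.I) := by
    have := Complex.norm_mul_exp_arg_mul_I w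
    rw [hw, Complex.ofReal_one, one_mul] at this
    exact this.symm
  -- Full turns make `Θ` unbounded in both directions, so there is a greatest index with `Θ i ≤ arg
  -- w`.
  have hmul : ∀ k : ℕ, Θ (n * k) = Θ 0 + 2 * Real.pi * k ∧
      Θ (-(n * k)) = Θ 0 - 2 * Real.pi * k := by
    intro k
    induction k with
    | zero => simp
    | succ k ih =>
      have e1 := h.add_period (n * k)
      have e2 := h.add_period (-(n * (k + 1 : ℕ)))
      rw [show -(n * ((k + 1 : ℕ) : ℤ)) + n = -(n * k) by push_cast; ring] at e2
      rw [show n * ((k + 1 : ℕ) : ℤ) = n * k + n by push_cast; ring] at *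
      push_cast
      constructor <;> linarith
  have hpi : 0 < 2 * Real.pi := by positivity
  obtain ⟨k, hk⟩ := exists_nat_gt ((w.arg - Θ 0) / (2 * Real.pi))
  obtain ⟨k', hk'⟩ := exists_nat_gt ((Θ 0 - w.arg) / (2 * Real.pi))
  rw [div_lt_iff₀ hpi] at hk hk'
  obtain ⟨i, hi, hmax⟩ := Int.exists_greatest_of_bdd (P := fun i => Θ i ≤ w.arg)
    ⟨n * k, fun i hi => by
      by_contra! hlt
      have := h.strictMono hlt
      rw [(hmul k).1] at this
      linarith⟩
    ⟨-(n * k'), by rw [(hmul k').2]; linarith⟩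
  refine ⟨i, w.arg, hwe, lt_of_le_of_ne hi ?_, ?_⟩
  · intro he
    exact hne ⟨p i, by rw [h.pos_eq, he, ← hwe]⟩
  · by_contra! h1
    have := hmax _ h1
    omega

end CircularLabelling

namespace OuterplaneDrawing

variable {V : Type*} {G : SimpleGraph V}

/-- A connected part of the closed disc that joins a point of the circle between two consecutive
adjacent vertices to a third vertex meets the arc of the edge between the two. -/
theorem inter_arc_nonempty (D : OuterplaneDrawing G) {n : ℤ} {p : ℤ → V} {Θ : ℤ → ℝ}
    (h : CircularLabelling D.pos n p Θ) {i j : ℤ} (hadj : G.Adj (p i) (p (i + 1)))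
    (hij : i + 1 < j) (hj : j < i + n) {φ : ℝ} (h1 : Θ i < φ) (h2 : φ < Θ (i + 1)) {S : Set ℂ}
    (hS : S ⊆ Metric.closedBall 0 1)
    (hSj : JoinedIn S (Complex.exp (φ * Complex.I)) (D.pos (p j))) :
    (S ∩ D.arc ⟨s(p i, p (i + 1)), hadj⟩).Nonempty := by
  have j1 := D.joinedIn_arc hadj
  rw [h.pos_eq, h.pos_eq] at j1
  rw [h.pos_eq] at hSj
  rw [Set.inter_comm]
  exact inter_nonempty_of_interlaced (D.arc_subset _) hS h1 h2 (h.strictMono hij)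
    (h.lt_add_two_pi hj) j1 hSj

theorem isClosed_arc (D : OuterplaneDrawing G) (e : G.edgeSet) : IsClosed (D.arc e) := by
  obtain ⟨e, he⟩ := e
  induction e with | _ u v => ?_
  obtain ⟨γ, -, hγ⟩ := D.arc_isArc u v he
  rw [← hγ]
  exact (isCompact_range γ.continuous).isClosed

/-- If the chord lay on the frontier, the outer face would come arbitrarily close to its midpoint
`m`. From a nearby point of that face a path leaves the disc through the gap between some `p i` and
`p (i + 1)`. This path, a small ball around `m` and half of the chord join the gap to a third
vertex, so they meet the boundary edge `p i p (i + 1)`, from which all three are disjoint. -/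
theorem not_onOuterFace [Finite V] (D : OuterplaneDrawing G) {n : ℤ} {p : ℤ → V} {Θ : ℤ → ℝ}
    (h : CircularLabelling D.pos n p Θ) (hn : 0 < n) (hcyc : ∀ i, G.Adj (p i) (p (i + 1)))
    {a b : ℤ} (hab : a + 2 ≤ b) (hb : b + 2 ≤ a + n) (hadj : G.Adj (p a) (p b)) :
    ¬ D.OnOuterFace ⟨s(p a, p b), hadj⟩ := by
  intro hout
  set e : G.edgeSet := ⟨s(p a, p b), hadj⟩ with he
  obtain ⟨γ, hγinj, hγ⟩ := D.arc_isArc (p a) (p b) hadj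
  set f : ℝ → ℂ := ⇑γ.extend with hf
  have hfc : Continuous f := γ.continuous_extend
  have hfe : ∀ s, f s ∈ D.arc e := fun s => by
    rw [he, ← hγ]; exact ⟨Set.projIcc 0 1 zero_le_one s, rfl⟩
  have hfinj : Set.InjOn f (Set.Icc 0 1) := by
    intro s hs t ht hst
    have := hγinj (a₁ := ⟨s, hs⟩) (a₂ := ⟨t, ht⟩) (by simpa [hf, γ.extend_apply hs, γ.extend_apply ht] using hst)
    exact congrArg Subtype.val this
  have f0 : f 0 = D.pos (p a) := by simp [hf]
  have f1 : f 1 = D.pos (p b) := by simp [hf]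
  have hvert : ∀ t ∈ Set.Icc (0 : ℝ) 1, ∀ v, f t = D.pos v → (t = 0 ∧ v = p a) ∨
      (t = 1 ∧ v = p b) := by
    intro t ht v hv
    have := D.mem_of_pos_mem_arc e v (hv ▸ hfe t)
    rw [he, Sym2.mem_iff] at this
    rcases this with rfl | rfl
    · exact Or.inl ⟨hfinj ht (by simp) (hv.trans f0.symm), rfl⟩
    · exact Or.inr ⟨hfinj ht (by simp) (hv.trans f1.symm), rfl⟩
  set m := f (1 / 2) with hm
  have hmv : m ∉ Set.range D.pos := by
    rintro ⟨v, hv⟩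
    rcases hvert (1 / 2) (by norm_num) v hv.symm with h1 | h1 <;> norm_num at h1
  -- from the midpoint of `e` one reaches, for any two consecutive vertices, another vertex
  -- without meeting the arc that joins these two
  have hmid : ∀ i : ℤ, ∃ j T, i + 1 < j ∧ j < i + n ∧ T ⊆ D.arc e ∧
      JoinedIn T m (D.pos (p j)) ∧ Disjoint T (D.arc ⟨s(p i, p (i + 1)), hcyc i⟩) ∧
      e ≠ ⟨s(p i, p (i + 1)), hcyc i⟩ := by
    intro i
    have hfin : ∀ j T, i + 1 < j → j < i + n → T ⊆ D.arc e → JoinedIn T m (D.pos (p j)) →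
        (∀ v, D.pos v ∈ T → v = p j) → p j ∈ e.1 → ∃ j T, i + 1 < j ∧ j < i + n ∧ T ⊆ D.arc e ∧
      JoinedIn T m (D.pos (p j)) ∧ Disjoint T (D.arc ⟨s(p i, p (i + 1)), hcyc i⟩) ∧
      e ≠ ⟨s(p i, p (i + 1)), hcyc i⟩ := by
      intro j T h1 h2 hT hTj hTv hje
      have hnot : p j ∉ s(p i, p (i + 1)) := by
        rw [Sym2.mem_iff]
        rintro (h3 | h3)
        · exact h.ne_of_lt (by omega) h2 h3.symm
        · exact h.ne_of_lt h1 (by omega) h3.symm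
      have hne : e ≠ ⟨s(p i, p (i + 1)), hcyc i⟩ := by
        intro h3
        rw [h3] at hje
        exact hnot hje
      refine ⟨j, T, h1, h2, hT, hTj, ?_, hne⟩
      rw [Set.disjoint_left]
      intro z hz hz'
      obtain ⟨v, rfl⟩ := D.arc_inter_arc _ _ hne ⟨hT hz, hz'⟩
      rw [hTv v hz] at hz'
      exact hnot (D.mem_of_pos_mem_arc _ _ hz')
    obtain ⟨a', ha1, ha2, ha'⟩ := h.exists_label hn i (p a)
    obtain ⟨b', hb1, hb2, hb'⟩ := h.exists_label hn i (p b)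
    by_cases hja : i + 1 < a'
    · refine hfin a' (f '' Set.Icc 0 (1 / 2)) hja ha2 ?_ ?_ ?_ ?_
      · rintro _ ⟨t, -, rfl⟩
        exact hfe t
      · rw [ha', ← f0]
        refine JoinedIn.symm ?_
        exact joinedIn_image_Icc (by norm_num) hfc.continuousOn fun t ht => ⟨t, ht, rfl⟩
      · rintro v ⟨t, ht, htv⟩
        rcases hvert t ⟨ht.1, ht.2.trans (by norm_num)⟩ v htv with h1 | h1
        · rw [h1.2, ha']
        · have := ht.2
          norm_num [h1.1] at this
      · rw [ha', he, Sym2.mem_iff]; exact Or.inl rfl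
    by_cases hjb : i + 1 < b'
    · refine hfin b' (f '' Set.Icc (1 / 2) 1) hjb hb2 ?_ ?_ ?_ ?_
      · rintro _ ⟨t, -, rfl⟩
        exact hfe t
      · rw [hb', ← f1]
        exact joinedIn_image_Icc (by norm_num) hfc.continuousOn fun t ht => ⟨t, ht, rfl⟩
      · rintro v ⟨t, ht, htv⟩
        rcases hvert t ⟨le_trans (by norm_num) ht.1, ht.2⟩ v htv with h1 | h1
        · have := ht.1
          norm_num [h1.1] at this
        · rw [h1.2, hb']
      · rw [hb', he, Sym2.mem_iff]; exact Or.inr rfl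
    -- Otherwise both ends of the chord are among `p i` and `p (i + 1)`, although they are at least
    -- two steps apart on both sides.
    exfalso
    have hab' : a' ≠ b' := by
      rintro rfl
      exact hadj.ne (ha'.symm.trans hb')
    have : b' = a' + 1 ∨ a' = b' + 1 := by omega
    rcases this with rfl | rfl
    · exact h.ne_of_lt (i := a + 1) (j := b) (by omega) (by omega)
        ((h.succ_eq ha').symm.trans hb')
    · refine h.ne_of_lt (i := b + 1) (j := a + n) (by omega) (by omega)
        ((h.succ_eq hb').symm.trans (ha'.trans ?_))
      have := h.apply_add_mul a 1
      rwa [mul_one, eq_comm] at this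
  -- Arcs need not be straight and could touch the circle; but then half of the chord would run from
  -- a gap to a third vertex and meet the edge closing that gap.
  have hm1 : ‖m‖ < 1 := by
    have hle : ‖m‖ ≤ 1 := mem_closedBall_zero_iff.1 (D.arc_subset e (hfe (1 / 2)))
    refine hle.lt_of_ne fun h1 => ?_
    obtain ⟨i, φ, hφ, hi1, hi2⟩ := h.exists_between h1 hmv
    obtain ⟨j, T, hj1, hj2, hT, hTj, hdisj, -⟩ := hmid i
    rw [hφ] at hTj
    exact Set.not_disjoint_iff_nonempty_inter.2 (D.inter_arc_nonempty h (hcyc i) hj1 hj2 hi1 hi2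
      (hT.trans (D.arc_subset e)) hTj) hdisj
  have hUo : IsOpen (Metric.ball (0 : ℂ) 1 ∩ (⋃ g : {g : G.edgeSet // g ≠ e}, D.arc g.1)ᶜ) :=
    Metric.isOpen_ball.inter (isClosed_iUnion_of_finite fun g => D.isClosed_arc _).isOpen_compl
  have hmU : m ∈ Metric.ball (0 : ℂ) 1 ∩ (⋃ g : {g : G.edgeSet // g ≠ e}, D.arc g.1)ᶜ := by
    refine ⟨by simpa using hm1, fun hmem => ?_⟩
    obtain ⟨g, hg⟩ := Set.mem_iUnion.1 hmem
    exact hmv (D.arc_inter_arc _ _ g.2 ⟨hg, hfe _⟩)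
  obtain ⟨ε, hε, hεU⟩ := Metric.isOpen_iff.1 hUo m hmU
  have hmcl : m ∈ closure D.outerFace := (hout (hfe (1 / 2))).1
  obtain ⟨q, hq, hqm⟩ := Metric.mem_closure_iff.1 hmcl ε hε
  have hqb : q ∈ Metric.ball m ε := by rwa [Metric.mem_ball']
  have hsupp : IsClosed D.support :=
    (Set.finite_range D.pos).isClosed.union (isClosed_iUnion_of_finite D.isClosed_arc)
  set K := connectedComponentIn D.supportᶜ q with hK
  have hKo : IsOpen K := hsupp.isOpen_compl.connectedComponentIn
  have hKsub : K ⊆ D.supportᶜ := connectedComponentIn_subset _ _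
  have hqK : q ∈ K := mem_connectedComponentIn hq.1
  have hKp : IsPathConnected K :=
    hKo.isConnected_iff_isPathConnected.1 (isConnected_connectedComponentIn_iff.2 hq.1)
  obtain ⟨z, hzK, hz⟩ : ∃ z ∈ K, 1 < ‖z‖ := by
    by_contra! hcon
    exact hq.2 ((Metric.isBounded_closedBall (x := (0 : ℂ)) (r := 1)).subset
      fun z hz => by simpa using hcon z hz)
  obtain ⟨w, hw, hqw⟩ := exists_joinedIn_sphere (hKp.joinedIn q hqK z hzK)
    (by have := (hεU hqb).1; rw [mem_ball_zero_iff] at this; exact this.le) hz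
  have hwv : w ∉ Set.range D.pos := fun hmem => hKsub hqw.target_mem.1 (Or.inl hmem)
  obtain ⟨i, φ, hφ, hi1, hi2⟩ := h.exists_between hw hwv
  obtain ⟨j, T, hj1, hj2, hT, hTj, hdisj, hne⟩ := hmid i
  have hqm' : JoinedIn (Metric.ball m ε) q m :=
    ((convex_ball m ε).isPathConnected ⟨q, hqb⟩).joinedIn _ hqb _ (Metric.mem_ball_self hε)
  have hall : JoinedIn ((K ∩ Metric.closedBall 0 1) ∪ Metric.ball m ε ∪ T) w (D.pos (p j)) :=
    ((hqw.symm.mono fun x hx => Or.inl (Or.inl hx)).trans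
      (hqm'.mono fun x hx => Or.inl (Or.inr hx))).trans (hTj.mono fun x hx => Or.inr hx)
  rw [hφ] at hall
  obtain ⟨y, hy, hy'⟩ := D.inter_arc_nonempty h (hcyc i) hj1 hj2 hi1 hi2 (by
    rintro x ((hx | hx) | hx)
    · exact hx.2
    · exact Metric.ball_subset_closedBall (hεU hx).1
    · exact D.arc_subset e (hT hx)) hall
  rcases hy with (hy | hy) | hy
  · exact hKsub hy.1 (Or.inr (Set.mem_iUnion.2 ⟨_, hy'⟩))
  · exact (hεU hy).2 (Set.mem_iUnion.2 ⟨⟨_, hne.symm⟩, hy'⟩)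
  · exact Set.disjoint_left.1 hdisj hy hy'

end OuterplaneDrawing

/-! ### Striped polygons -/

/-- `G` is a triangulated polygon with vertices `p 0, …, p (n - 1)`, numbered cyclically, in which
every triangle has a side on the boundary. -/
structure IsStripedPolygon {V : Type*} (G : SimpleGraph V) (n : ℤ) (p : ℤ → V) : Prop where
  surjective : Function.Surjective p
  eq_iff : ∀ i j, p i = p j ↔ n ∣ j - i
  noncrossing : ∀ a b c d, a < c → c < b → b < d → d < a + n → G.Adj (p a) (p b) →
    ¬ G.Adj (p c) (p d)
  maximal : ∀ a b, a < b → b < a + n → ¬ G.Adj (p a) (p b) →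
    ∃ c d, a < c ∧ c < b ∧ b < d ∧ d < a + n ∧ G.Adj (p c) (p d)
  striped : ∀ a b c, a < b → b < c → c < a + n → G.Adj (p a) (p b) → G.Adj (p b) (p c) →
    G.Adj (p a) (p c) → b = a + 1 ∨ c = b + 1 ∨ c + 1 = a + n

/-- A missing chord that no edge crosses could be added in a straight-line drawing, against
maximality. A triangle without a boundary side would consist of three chords off the outer face and
be internal. -/
theorem exists_isStripedPolygon {V : Type*} [Fintype V] {G : SimpleGraph V}
    (D : OuterplaneDrawing G) {n : ℕ} (hcard : Fintype.card V = n) (hn : 0 < n)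
    (hmax : IsMaximalOuterplanar G) (hstriped : D.IsStriped) :
    ∃ p : ℤ → V, IsStripedPolygon G n p := by
  obtain ⟨p, Θ, h⟩ := exists_circularLabelling D.pos_injective D.norm_pos hcard hn
  have hn' : (0 : ℤ) < n := by exact_mod_cast hn
  have hnc : ∀ a b c d : ℤ, a < c → c < b → b < d → d < a + n → G.Adj (p a) (p b) →
      ¬ G.Adj (p c) (p d) := fun a b c d h1 h2 h3 h4 h5 => D.not_adj_of_interlaced h h1 h2 h3 h4 h5
  have hmax' : ∀ a b : ℤ, a < b → b < a + n → ¬ G.Adj (p a) (p b) →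
      ∃ c d, a < c ∧ c < b ∧ b < d ∧ d < a + n ∧ G.Adj (p c) (p d) := by
    intro a b hab hb hnadj
    by_contra! hcon
    refine hmax.2 (p a) (p b) (h.ne_of_lt hab hb) hnadj
      (h.isOuterplanar hn' D.pos_injective D.norm_pos ?_)
    -- an edge of `G` cannot cross the new edge
    have key : ∀ a' b' c d : ℤ, a' < c → c < b' → b' < d → d < a' + n → p a' = p a → p b' = p b →
        ¬ G.Adj (p c) (p d) := by
      intro a' b' c d h1 h2 h3 h4 ha hb' hcd
      obtain ⟨k, hk⟩ := (h.eq_iff _ _).1 ha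
      have e1 : p (b' + n * k) = p b := (h.apply_add_mul b' k).trans hb'
      have e2 : b' + n * k = b := by
        by_contra hne
        rcases lt_or_gt_of_ne hne with h5 | h5
        · exact h.ne_of_lt h5 (by omega) e1
        · exact h.ne_of_lt h5 (by omega) e1.symm
      refine hcon (c + n * k) (d + n * k) (by omega) (by omega) (by omega) (by omega) ?_
      rwa [h.apply_add_mul, h.apply_add_mul]
    have key2 : ∀ a' b' c d : ℤ, a' < c → c < b' → b' < d → d < a' + n →
        (p a' = p a ∧ p b' = p b ∨ p a' = p b ∧ p b' = p a) → ¬ G.Adj (p c) (p d) := by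
      rintro a' b' c d h1 h2 h3 h4 (⟨ha, hb'⟩ | ⟨ha, hb'⟩) hcd
      · exact key a' b' c d h1 h2 h3 h4 ha hb' hcd
      · have e := h.apply_add_mul a' 1
        have e' := h.apply_add_mul c 1
        rw [mul_one] at e e'
        exact key b' (a' + n) d (c + n) h3 h4 (by omega) (by omega) hb' (e.trans ha)
          (by rw [e']; exact hcd.symm)
    intro a' b' c d h1 h2 h3 h4 hab' hcd
    rw [SimpleGraph.sup_adj, SimpleGraph.edge_adj] at hab' hcd
    rcases hab' with hab' | ⟨hab', -⟩ <;> rcases hcd with hcd | ⟨hcd, -⟩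
    · exact hnc _ _ _ _ h1 h2 h3 h4 hab' hcd
    · have e := h.apply_add_mul a' 1
      rw [mul_one] at e
      exact key2 c d b' (a' + n) h2 h3 h4 (by omega) (by tauto) (by rw [e]; exact hab'.symm)
    · exact key2 a' b' c d h1 h2 h3 h4 (by tauto) hcd
    · have n1 := h.ne_of_lt h1 (by omega)
      have n2 := h.ne_of_lt (h1.trans (h2.trans h3)) (by omega)
      rcases hab' with ⟨e1, e2⟩ | ⟨e1, e2⟩ <;> rcases hcd with ⟨e3, e4⟩ | ⟨e3, e4⟩
      · exact n1 (e1.trans e3.symm)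
      · exact n2 (e1.trans e4.symm)
      · exact n2 (e1.trans e4.symm)
      · exact n1 (e1.trans e3.symm)
  refine ⟨p, h.surjective, h.eq_iff, hnc, hmax', ?_⟩
  intro a b c hab hbc hc e1 e2 e3
  by_contra! hcon
  have hcyc : ∀ i, G.Adj (p i) (p (i + 1)) := by
    intro i
    by_contra hni
    obtain ⟨x, y, h1, h2, -⟩ := hmax' i (i + 1) (by omega) (by omega) hni
    omega
  have e := h.apply_add_mul a 1
  rw [mul_one] at e
  refine hstriped (p a) (p b) (p c) ⟨e1, e2, e3.symm, ?_, ?_, ?_⟩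
  · exact D.not_onOuterFace h hn' hcyc (by omega) (by omega) e1
  · exact D.not_onOuterFace h hn' hcyc (by omega) (by omega) e2
  · have := D.not_onOuterFace h hn' hcyc (a := c) (b := a + n) (by omega) (by omega)
      (by rw [e]; exact e3.symm)
    simpa only [e] using this

namespace IsStripedPolygon

variable {V : Type*} {G : SimpleGraph V} {n : ℤ} {p : ℤ → V}

theorem ne_of_lt (h : IsStripedPolygon G n p) {i j : ℤ} (h1 : i < j) (h2 : j < i + n) :
    p i ≠ p j := by
  intro he
  have := Int.eq_zero_of_abs_lt_dvd ((h.eq_iff i j).1 he) (by rw [abs_lt]; omega)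
  omega

theorem apply_add (h : IsStripedPolygon G n p) (i : ℤ) : p (i + n) = p i :=
  (h.eq_iff _ _).2 ⟨-1, by ring⟩

theorem apply_period (h : IsStripedPolygon G n p) : p n = p 0 :=
  (h.eq_iff _ _).2 ⟨-1, by ring⟩

theorem exists_label (h : IsStripedPolygon G n p) (hn : 0 < n) (a : ℤ) (v : V) :
    ∃ i, a ≤ i ∧ i < a + n ∧ p i = v := by
  obtain ⟨j, rfl⟩ := h.surjective v
  refine ⟨a + (j - a) % n, ?_, ?_, (h.eq_iff _ _).2 ?_⟩
  · have := Int.emod_nonneg (j - a) hn.ne'; omega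
  · have := Int.emod_lt_of_pos (j - a) hn; omega
  · exact ⟨(j - a) / n, by have := Int.emod_add_mul_ediv (j - a) n; linarith⟩

theorem shift (h : IsStripedPolygon G n p) (s : ℤ) :
    IsStripedPolygon G n fun i => p (i + s) where
  surjective v := by
    obtain ⟨i, rfl⟩ := h.surjective v
    exact ⟨i - s, by simp⟩
  eq_iff i j := by rw [h.eq_iff]; simp
  noncrossing a b c d h1 h2 h3 h4 := h.noncrossing _ _ _ _ (by omega) (by omega) (by omega)
    (by omega)
  maximal a b h1 h2 h3 := by
    obtain ⟨c, d, h4, h5, h6, h7, h8⟩ := h.maximal (a + s) (b + s) (by omega) (by omega) h3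
    exact ⟨c - s, d - s, by omega, by omega, by omega, by omega, by simpa using h8⟩
  striped a b c h1 h2 h3 h4 h5 h6 := by
    have := h.striped (a + s) (b + s) (c + s) (by omega) (by omega) (by omega) h4 h5 h6
    omega

theorem reflect (h : IsStripedPolygon G n p) : IsStripedPolygon G n fun i => p (-i) where
  surjective v := by
    obtain ⟨i, rfl⟩ := h.surjective v
    exact ⟨-i, by simp⟩
  eq_iff i j := by
    rw [h.eq_iff, show -j - -i = -(j - i) by ring, Int.dvd_neg]
  noncrossing a b c d h1 h2 h3 h4 h5 h6 := h.noncrossing (-d) (-c) (-b) (-a) (by omega) (by omega)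
    (by omega) (by omega) h6.symm h5.symm
  maximal a b h1 h2 h3 := by
    obtain ⟨c, d, h4, h5, h6, h7, h8⟩ := h.maximal (-b) (-a) (by omega) (by omega)
      fun h8 => h3 h8.symm
    refine ⟨-c, -d + n, by omega, by omega, by omega, by omega, ?_⟩
    have := h.apply_add (d - n)
    rw [sub_add_cancel] at this
    rw [neg_neg, show -(-d + n) = d - n by ring, ← this]
    exact h8
  striped a b c h1 h2 h3 h4 h5 h6 := by
    have := h.striped (-c) (-b) (-a) (by omega) (by omega) (by omega) h5.symm h4.symm h6.symm
    omega

theorem adj_succ (h : IsStripedPolygon G n p) (hn : 1 < n) (i : ℤ) : G.Adj (p i) (p (i + 1)) := by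
  by_contra hni
  obtain ⟨x, y, h1, h2, -⟩ := h.maximal i (i + 1) (by omega) (by omega) hni
  omega

theorem adj_pred (h : IsStripedPolygon G n p) (hn : 1 < n) (i : ℤ) : G.Adj (p (i - 1)) (p i) := by
  have := h.adj_succ hn (i - 1)
  rwa [sub_add_cancel] at this

/-- Every edge spans a triangle on each of its nonempty sides. -/
theorem exists_triangle (h : IsStripedPolygon G n p) {a b : ℤ} (hab : a + 2 ≤ b) (hb : b < a + n)
    (hadj : G.Adj (p a) (p b)) : ∃ c, a < c ∧ c < b ∧ G.Adj (p a) (p c) ∧ G.Adj (p c) (p b) := by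
  -- The apex is the last neighbour of `p a` before `b`. An edge crossing `p c p b` would cross `p a
  -- p b` or `p a p c`, or end at `p a` and give a later neighbour.
  obtain ⟨c, ⟨h1, h2, h3⟩, hmax⟩ := Int.exists_greatest_of_bdd
    (P := fun c => a < c ∧ c < b ∧ G.Adj (p a) (p c)) ⟨b, fun z hz => hz.2.1.le⟩
    ⟨a + 1, by omega, by omega, h.adj_succ (by omega) a⟩
  refine ⟨c, h1, h2, h3, ?_⟩
  by_contra hcb
  obtain ⟨x, y, h4, h5, h6, h7, h8⟩ := h.maximal c b h2 (by omega) hcb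
  rcases lt_trichotomy y (a + n) with h9 | rfl | h9
  · exact h.noncrossing a b x y (by omega) h5 h6 h9 hadj h8
  · rw [h.apply_add] at h8
    have := hmax x ⟨by omega, h5, h8.symm⟩
    omega
  · have e := h.apply_add (y - n)
    rw [sub_add_cancel] at e
    rw [e] at h8
    exact h.noncrossing a c (y - n) x (by omega) (by omega) h4 (by omega) h3 h8.symm

/-- Every chord cuts off an ear. -/
theorem exists_ear (h : IsStripedPolygon G n p) : ∀ (m : ℕ) {a b : ℤ}, b - a = m + 2 → b < a + n →
    G.Adj (p a) (p b) → ∃ c, a < c ∧ c < b ∧ G.Adj (p (c - 1)) (p (c + 1)) := by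
  intro m
  induction m using Nat.strong_induction_on with
  | _ m ih =>
  intro a b hab hb hadj
  obtain ⟨c, h1, h2, h3, h4⟩ := h.exists_triangle (by omega) hb hadj
  by_cases hca : c = a + 1
  · by_cases hcb : b = c + 1
    · refine ⟨c, h1, h2, ?_⟩
      rwa [hca, add_sub_cancel_right, ← hca, ← hcb]
    · obtain ⟨x, h5, h6, h7⟩ := ih (m - 1) (by omega) (a := c) (b := b) (by omega) (by omega) h4
      exact ⟨x, by omega, h6, h7⟩
  · obtain ⟨x, h5, h6, h7⟩ := ih (c - a - 2).toNat (by omega) (a := a) (b := c) (by omega)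
      (by omega) h3
    exact ⟨x, h5, by omega, h7⟩

theorem connected (h : IsStripedPolygon G n p) (hn : 1 < n) : G.Connected := by
  have hr : ∀ m : ℕ, G.Reachable (p 0) (p m) := by
    intro m
    induction m with
    | zero => exact SimpleGraph.Reachable.refl _
    | succ m ih => exact ih.trans (by push_cast; exact (h.adj_succ hn m).reachable)
  have hr' : ∀ v, G.Reachable (p 0) v := by
    intro v
    obtain ⟨i, hi, -, rfl⟩ := h.exists_label (by omega) 0 v
    have := hr i.toNat
    rwa [Int.toNat_of_nonneg hi] at this
  have : Nonempty V := ⟨p 0⟩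
  exact ⟨fun u v => (hr' u).symm.trans (hr' v)⟩

end IsStripedPolygon

/-- A striped polygon in which `p 1` is an ear and `p 0` is adjacent exactly to `p 1, …, p k` and
to `p (n - 1)`. -/
structure IsHubLabelling {V : Type*} (G : SimpleGraph V) (n : ℤ) (p : ℤ → V) (k : ℤ) : Prop
    extends IsStripedPolygon G n p where
  three_le : 3 ≤ k
  le : k + 2 ≤ n
  adj_zero : ∀ i, 1 ≤ i → i ≤ k → G.Adj (p 0) (p i)
  adj_last : G.Adj (p k) (p (n - 1))
  not_adj_zero : ∀ i, k < i → i + 1 < n → ¬ G.Adj (p 0) (p i)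

theorem IsStripedPolygon.exists_hub_of_adj {V : Type*} {G : SimpleGraph V} {n : ℤ} {p : ℤ → V}
    (h : IsStripedPolygon G n p) (hn : 5 ≤ n) (h2 : G.Adj (p 0) (p 2)) (h3 : G.Adj (p 0) (p 3)) :
    ∃ k, IsHubLabelling G n p k := by
  have h1 := h.adj_succ (by omega) 0
  rw [zero_add] at h1
  -- By maximality of `k` the triangle beyond `p 0 p k` cannot have apex `p (k + 1)`, so stripedness
  -- puts its apex at `p (n - 1)`. The cap `k + 2 ≤ n` keeps `p (n - 1)` out of the run; at `k + 2 =
  -- n` the edge `p k p (n - 1)` is a boundary edge.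
  obtain ⟨k, ⟨hk1, hk2⟩, hmax⟩ := Int.exists_greatest_of_bdd
    (P := fun k => k + 2 ≤ n ∧ ∀ i, 1 ≤ i → i ≤ k → G.Adj (p 0) (p i))
    ⟨n, fun z hz => by omega⟩ ⟨3, by omega, fun i h4 h5 => by
      obtain rfl | rfl | rfl : i = 1 ∨ i = 2 ∨ i = 3 := by omega
      exacts [h1, h2, h3]⟩
  have hk3 : 3 ≤ k := hmax 3 ⟨by omega, fun i h4 h5 => by
      obtain rfl | rfl | rfl : i = 1 ∨ i = 2 ∨ i = 3 := by omega
      exacts [h1, h2, h3]⟩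
  have hlast : G.Adj (p k) (p (n - 1)) := by
    by_cases hkn : k + 2 = n
    · have := h.adj_succ (by omega) k
      rwa [show k + 1 = n - 1 by omega] at this
    · have hnot : ¬ G.Adj (p 0) (p (k + 1)) := by
        intro hadj
        have := hmax (k + 1) ⟨by omega, fun i h4 h5 => by
          rcases (show i ≤ k ∨ i = k + 1 by omega) with h6 | rfl
          exacts [hk2 i h4 h6, hadj]⟩
        omega
      have e := h.apply_period
      obtain ⟨c, h4, h5, h6, h7⟩ := h.exists_triangle (a := k) (b := n) (by omega) (by omega)
        (by rw [e]; exact (hk2 k (by omega) le_rfl).symm)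
      rcases h.striped k c n h4 h5 (by omega) h6 h7
        (by rw [e]; exact (hk2 k (by omega) le_rfl).symm) with rfl | h8 | h8
      · rw [e] at h7
        exact absurd h7.symm hnot
      · rwa [show n - 1 = c by omega]
      · omega
  refine ⟨k, h, hk3, hk1, hk2, hlast, fun i h4 h5 h6 => ?_⟩
  exact h.noncrossing 0 i k (n - 1) (by omega) h4 (by omega) (by omega) h6 hlast

/-- A striped polygon has a hub labelling starting at any ear. -/
theorem IsStripedPolygon.exists_hub {V : Type*} {G : SimpleGraph V} {n : ℤ} {p : ℤ → V}
    (h : IsStripedPolygon G n p) (hn : 5 ≤ n) {i : ℤ} (hear : G.Adj (p (i - 1)) (p (i + 1))) :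
    ∃ q k, IsHubLabelling G n q k ∧ q 1 = p i := by
  have e := h.apply_add (i - 1)
  -- The triangle across the chord of the ear has its apex next to one end of that chord. The other
  -- end becomes the hub; one of the two cases needs a reflection.
  obtain ⟨c, h1, h2, h3, h4⟩ := h.exists_triangle (a := i + 1) (b := i - 1 + n) (by omega)
    (by omega) (by rw [e]; exact hear.symm)
  rcases h.striped _ _ _ h1 h2 (by omega) h3 h4 (by rw [e]; exact hear.symm) with rfl | h5 | h5
  · obtain ⟨k, hk⟩ := (h.shift (i - 1)).exists_hub_of_adj hn
      (by ring_nf at hear ⊢; exact hear) (by rw [e] at h4; ring_nf at h4 ⊢; exact h4.symm)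
    exact ⟨_, k, hk, by simp⟩
  · obtain ⟨k, hk⟩ := ((h.shift (i + 1)).reflect).exists_hub_of_adj hn
      (by ring_nf at hear ⊢; exact hear.symm) (by
        have e' := h.apply_add (i - 2)
        rw [show i - 2 + n = c by omega] at e'
        rw [e'] at h3
        ring_nf at h3 ⊢; exact h3)
    exact ⟨_, k, hk, by simp⟩
  · omega

namespace IsHubLabelling

variable {V : Type*} {G : SimpleGraph V} {n k : ℤ} {p : ℤ → V}

theorem adj_zero_last (h : IsHubLabelling G n p k) : G.Adj (p 0) (p (n - 1)) := by
  have := h.adj_pred (by have := h.three_le; have := h.le; omega) n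
  rw [h.apply_period] at this
  exact this.symm

/-- The spokes from the hub to `p (i - 1)` and `p (i + 1)` shut `p i` off from all other vertices.
-/
theorem eq_of_adj (h : IsHubLabelling G n p k) {i j : ℤ} (hi : 1 ≤ i) (hik : i < k) (hj : 0 ≤ j)
    (hjn : j < n) (hadj : G.Adj (p i) (p j)) : j = 0 ∨ j = i - 1 ∨ j = i + 1 := by
  have := h.le
  by_contra! hcon
  rcases lt_trichotomy j i with h1 | rfl | h1
  · exact h.noncrossing 0 (i - 1) j i (by omega) (by omega) (by omega) (by omega)
      (h.adj_zero _ (by omega) (by omega)) hadj.symm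
  · exact hadj.ne rfl
  · exact h.noncrossing 0 (i + 1) i j (by omega) (by omega) (by omega) (by omega)
      (h.adj_zero _ (by omega) (by omega)) hadj

theorem adj_zero_iff (h : IsHubLabelling G n p k) {i : ℤ} (hi : 0 ≤ i) (hin : i < n) :
    G.Adj (p 0) (p i) ↔ 1 ≤ i ∧ (i ≤ k ∨ i = n - 1) := by
  constructor
  · intro hadj
    have : i ≠ 0 := by rintro rfl; exact hadj.ne rfl
    refine ⟨by omega, ?_⟩
    by_contra! h1
    exact h.not_adj_zero i (by omega) (by omega) hadj
  · rintro ⟨h1, h2 | rfl⟩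
    · exact h.adj_zero i h1 h2
    · exact h.adj_zero_last

end IsHubLabelling

/-! ### Distances and general position -/

section Distance

variable {V : Type*} {G : SimpleGraph V}

theorem IsGeneralPosition.dist_add_dist_ne {R : Finset V} (hR : IsGeneralPosition G R)
    (hG : G.Connected) {x y z : V} (hx : x ∈ R) (hy : y ∈ R) (hz : z ∈ R) (hxy : x ≠ y)
    (hyz : y ≠ z) (hxz : x ≠ z) : G.dist x y + G.dist y z ≠ G.dist x z := by
  intro he
  obtain ⟨w₁, h₁⟩ := hG.exists_walk_length_eq_dist x y
  obtain ⟨w₂, h₂⟩ := hG.exists_walk_length_eq_dist y z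
  refine hR x hx y hy z hz hxy hyz hxz (w₁.append w₂)
    (by rw [SimpleGraph.Walk.length_append, h₁, h₂, he]) ?_
  rw [SimpleGraph.Walk.mem_support_append_iff]
  exact Or.inl w₁.end_mem_support

/-- The condition is asked only for reachable pairs, because `dist` takes the value 0 on unreachable
ones. -/
theorem isGeneralPosition_of_dist_add_dist_ne {R : Finset V} (h : ∀ x ∈ R, ∀ y ∈ R, ∀ z ∈ R,
    x ≠ y → y ≠ z → x ≠ z → G.Reachable x y → G.Reachable y z →
      G.dist x y + G.dist y z ≠ G.dist x z) : IsGeneralPosition G R := by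
  classical
  intro x hx y hy z hz hxy hyz hxz w hw hmem
  have h1 := SimpleGraph.dist_le (w.takeUntil y hmem)
  have h2 := SimpleGraph.dist_le (w.dropUntil y hmem)
  have h3 := congrArg SimpleGraph.Walk.length (w.take_spec hmem)
  rw [SimpleGraph.Walk.length_append] at h3
  have h4 := (w.takeUntil y hmem).reachable.dist_triangle_left z
  exact h x hx y hy z hz hxy hyz hxz (w.takeUntil y hmem).reachable
    (w.dropUntil y hmem).reachable (by omega)

theorem exists_adj_dist_eq (hG : G.Connected) {u v : V} (huv : u ≠ v) :
    ∃ y, G.Adj u y ∧ G.dist u v = G.dist y v + 1 := by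
  obtain ⟨w, hw⟩ := hG.exists_walk_length_eq_dist u v
  cases w with
  | nil => exact absurd rfl huv
  | cons hadj w' =>
    rename_i y
    refine ⟨y, hadj, ?_⟩
    rw [SimpleGraph.Walk.length_cons] at hw
    have h1 := SimpleGraph.dist_le w'
    have h2 := hG.dist_triangle (u := u) (v := y) (w := v)
    rw [SimpleGraph.dist_eq_one_iff_adj.2 hadj] at h2
    omega

theorem dist_le_succ_of_adj (hG : G.Connected) {u v y : V} (h : G.Adj u y) :
    G.dist u v ≤ G.dist y v + 1 := by
  have h2 := hG.dist_triangle (u := u) (v := y) (w := v)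
  rw [SimpleGraph.dist_eq_one_iff_adj.2 h] at h2
  omega

theorem dist_eq_two (hG : G.Connected) {u v y : V} (huv : u ≠ v) (hnadj : ¬ G.Adj u v)
    (h1 : G.Adj u y) (h2 : G.Adj y v) : G.dist u v = 2 := by
  have h3 := hG.one_lt_dist_of_ne_of_not_adj huv hnadj
  have h4 := dist_le_succ_of_adj hG (v := v) h1
  rw [SimpleGraph.dist_eq_one_iff_adj.2 h2] at h4
  omega

theorem three_le_dist (hG : G.Connected) {u v : V} (huv : u ≠ v) (hnadj : ¬ G.Adj u v)
    (h : ∀ y, G.Adj u y → ¬ G.Adj y v) : 3 ≤ G.dist u v := by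
  obtain ⟨y, h1, h2⟩ := exists_adj_dist_eq hG huv
  have h3 : y ≠ v := by rintro rfl; exact hnadj h1
  have := hG.one_lt_dist_of_ne_of_not_adj h3 (h y h1)
  omega

end Distance

/-! ### Separating chords and indicator sums -/

namespace IsStripedPolygon

variable {V : Type*} {G : SimpleGraph V} {n : ℤ} {p : ℤ → V}

/-- The ends of a chord separate its two sides. -/
theorem mem_support_of_chord (h : IsStripedPolygon G n p) (hn : 0 < n) {a b : ℤ}
    (hadj : G.Adj (p a) (p b)) {u v : V} (w : G.Walk u v)
    (hu : ∃ x, a < x ∧ x < b ∧ p x = u) (hv : ∃ y, b < y ∧ y < a + n ∧ p y = v) :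
    p a ∈ w.support ∨ p b ∈ w.support := by
  induction w with
  | nil =>
    obtain ⟨x, h1, h2, rfl⟩ := hu
    obtain ⟨y, h3, h4, h5⟩ := hv
    exact absurd h5.symm (h.ne_of_lt (by omega) (by omega))
  | cons hadj' w' ih =>
    obtain ⟨x, h1, h2, rfl⟩ := hu
    rename_i v' w''
    obtain ⟨x', h3, h4, rfl⟩ := h.exists_label hn a v'
    simp only [SimpleGraph.Walk.support_cons, List.mem_cons]
    rcases h3.eq_or_lt with rfl | h3
    · exact Or.inl (Or.inr w'.start_mem_support)
    rcases lt_trichotomy x' b with h5 | rfl | h5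
    · rcases ih ⟨x', h3, h5, rfl⟩ hv with h6 | h6
      · exact Or.inl (Or.inr h6)
      · exact Or.inr (Or.inr h6)
    · exact Or.inr (Or.inr w'.start_mem_support)
    · exact absurd hadj' (h.noncrossing a b x x' h1 h2 h5 h4 hadj)

/-- A geodesic from `p d` to `p c` has to pass through an end of the separating edge `p a p b`. -/
theorem false_of_triangle (h : IsStripedPolygon G n p) (hn : 1 < n) {R : Finset V}
    (hR : IsGeneralPosition G R) {a b c d : ℤ} (had : a < d) (hdb : d < b) (hbc : b < c)
    (hc : c < a + n) (ha : p a ∈ R) (hb : p b ∈ R) (hc' : p c ∈ R) (hd : p d ∈ R)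
    (hadj : G.Adj (p a) (p b)) : False := by
  obtain ⟨w, hw⟩ := (h.connected hn).exists_walk_length_eq_dist (p d) (p c)
  have n1 := h.ne_of_lt (hdb.trans hbc) (by omega)
  rcases h.mem_support_of_chord (by omega) hadj w ⟨d, had, hdb, rfl⟩ ⟨c, hbc, hc, rfl⟩ with h1 | h1
  · exact hR _ hd _ ha _ hc' (h.ne_of_lt had (by omega)).symm (h.ne_of_lt (by omega) hc) n1 w hw h1
  · exact hR _ hd _ hb _ hc' (h.ne_of_lt hdb (by omega)) (h.ne_of_lt hbc (by omega)) n1 w hw h1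

/-- A general position set with at least four vertices contains no three vertices that induce a
connected subgraph. -/
theorem not_adj_of_adj (h : IsStripedPolygon G n p) (hn : 1 < n) {R : Finset V}
    (hR : IsGeneralPosition G R) (h4 : 4 ≤ R.card) {x y z : V} (hx : x ∈ R) (hy : y ∈ R)
    (hz : z ∈ R) (hxz : x ≠ z) (hxy : G.Adj x y) : ¬ G.Adj y z := by
  classical
  intro hyz
  have hG := h.connected hn
  by_cases hadj : G.Adj x z
  -- In a triangle, a fourth vertex lies beyond one side, and that side separates it from the
  -- opposite corner. Without the edge `x z`, the path `x, y, z` is itself a geodesic.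
  · obtain ⟨w, hw, hw'⟩ : ∃ w ∈ R, w ∉ ({x, y, z} : Finset V) := by
      apply Finset.exists_mem_notMem_of_card_lt_card
      exact lt_of_le_of_lt Finset.card_le_three h4
    simp only [Finset.mem_insert, Finset.mem_singleton, not_or] at hw'
    obtain ⟨hwx, hwy, hwz⟩ := hw'
    obtain ⟨a, -, -, rfl⟩ := h.exists_label (by omega) 0 x
    obtain ⟨b, hb1, hb2, rfl⟩ := h.exists_label (by omega) a y
    obtain ⟨c, hc1, hc2, rfl⟩ := h.exists_label (by omega) a z
    obtain ⟨d, hd1, hd2, rfl⟩ := h.exists_label (by omega) a w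
    have e := h.apply_add a
    have e' := h.apply_add b
    have e'' := h.apply_add c
    have key : ∀ b c, a < b → b < c → c < a + n → p b ∈ R → p c ∈ R → G.Adj (p a) (p b) →
        G.Adj (p b) (p c) → G.Adj (p a) (p c) → p d ≠ p b → p d ≠ p c → False := by
      intro b c h1 h2 h3 hb hc h4 h5 h6 h7 h8
      have ha : a ≠ d := by rintro rfl; exact hwx rfl
      have hb' : b ≠ d := by rintro rfl; exact h7 rfl
      have hc' : c ≠ d := by rintro rfl; exact h8 rfl
      have e' := h.apply_add b
      rcases lt_or_gt_of_ne hb' with h9 | h9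
      · rcases lt_or_gt_of_ne hc' with h10 | h10
        · exact h.false_of_triangle hn hR (a := c) (b := a + n) (c := b + n) (d := d) h10 hd2
            (by omega) (by omega) hc (by rwa [e]) (by rwa [e']) hw (by rw [e]; exact h6.symm)
        · exact h.false_of_triangle hn hR (a := b) (b := c) (c := a + n) (d := d) h9 h10
            (by omega) (by omega) hb hc (by rwa [e]) hw h5
      · exact h.false_of_triangle hn hR (a := a) (b := b) (c := c) (d := d) (by omega) h9
            (by omega) (by omega) hx hb hc hw h4
    have ha : a ≠ b := by rintro rfl; exact hxy.ne rfl
    have hb : b ≠ c := by rintro rfl; exact hyz.ne rfl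
    have hc : a ≠ c := by rintro rfl; exact hxz rfl
    rcases lt_or_gt_of_ne hb with h1 | h1
    · exact key b c (by omega) h1 hc2 hy hz hxy hyz hadj hwy hwz
    · exact key c b (by omega) h1 hb2 hz hy hadj hyz.symm hxy hwz hwy
  · exact hR.dist_add_dist_ne hG hx hy hz hxy.ne hyz.ne hxz (by
      rw [dist_eq_two hG hxz hadj hxy hyz, SimpleGraph.dist_eq_one_iff_adj.2 hxy,
        SimpleGraph.dist_eq_one_iff_adj.2 hyz])

/-- The indicator function of a set of vertices along the boundary. -/
noncomputable def indicator (p : ℤ → V) (R : Finset V) (i : ℤ) : ℤ :=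
  open Classical in if p i ∈ R then 1 else 0

theorem indicator_bounds (p : ℤ → V) (R : Finset V) (i : ℤ) :
    0 ≤ indicator p R i ∧ indicator p R i ≤ 1 := by
  unfold indicator; split_ifs <;> simp

theorem indicator_of_mem {R : Finset V} {i : ℤ} (h : p i ∈ R) : indicator p R i = 1 := by
  simp [indicator, h]

theorem indicator_of_notMem {R : Finset V} {i : ℤ} (h : p i ∉ R) : indicator p R i = 0 := by
  simp [indicator, h]

theorem sum_indicator (h : IsStripedPolygon G n p) (hn : 0 < n) (R : Finset V) (a : ℤ) :
    ∑ i ∈ Finset.Ico a (a + n), indicator p R i = R.card := by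
  classical
  unfold indicator
  rw [Finset.sum_boole]
  congr 1
  refine Finset.card_bij (fun i _ => p i) ?_ ?_ ?_
  · intro i hi
    exact (Finset.mem_filter.1 hi).2
  · intro i hi j hj hij
    simp only [Finset.mem_filter, Finset.mem_Ico] at hi hj
    rcases lt_trichotomy i j with h1 | h1 | h1
    · exact absurd hij (h.ne_of_lt h1 (by omega))
    · exact h1
    · exact absurd hij.symm (h.ne_of_lt h1 (by omega))
  · intro v hv
    obtain ⟨i, h1, h2, rfl⟩ := h.exists_label hn a v
    exact ⟨i, by simp [h1, h2, hv], rfl⟩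

end IsStripedPolygon

/-! ### Sums of 0-1 sequences without three consecutive ones -/

section Sums

variable {f : ℤ → ℤ}

theorem sum_Ico_split (f : ℤ → ℤ) {a b c : ℤ} (hab : a ≤ b) (hbc : b ≤ c) :
    ∑ i ∈ Finset.Ico a c, f i = ∑ i ∈ Finset.Ico a b, f i + ∑ i ∈ Finset.Ico b c, f i := by
  rw [← Finset.sum_union (Finset.Ico_disjoint_Ico_consecutive a b c),
    Finset.Ico_union_Ico_eq_Ico hab hbc]

theorem sum_Ico_one (f : ℤ → ℤ) (a : ℤ) : ∑ i ∈ Finset.Ico a (a + 1), f i = f a := by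
  have : Finset.Ico a (a + 1) = {a} := by ext; simp; omega
  rw [this, Finset.sum_singleton]

theorem sum_Ico_head (f : ℤ → ℤ) {a b : ℤ} (hab : a < b) :
    ∑ i ∈ Finset.Ico a b, f i = f a + ∑ i ∈ Finset.Ico (a + 1) b, f i := by
  rw [sum_Ico_split f (b := a + 1) (by omega) (by omega), sum_Ico_one]

theorem sum_Ico_last (f : ℤ → ℤ) {a b : ℤ} (hab : a < b) :
    ∑ i ∈ Finset.Ico a b, f i = ∑ i ∈ Finset.Ico a (b - 1), f i + f (b - 1) := by
  have := sum_Ico_one f (b - 1)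
  rw [sub_add_cancel] at this
  rw [sum_Ico_split f (b := b - 1) (by omega) (by omega), this]

theorem three_mul_sum_le (hf : ∀ i, 0 ≤ f i ∧ f i ≤ 1) {b : ℤ} : ∀ (m : ℕ) {a : ℤ}, b - a = m →
    (∀ i, a ≤ i → i + 3 ≤ b → f i + f (i + 1) + f (i + 2) ≤ 2) →
      3 * ∑ i ∈ Finset.Ico a b, f i ≤ 2 * (b - a) + 2 := by
  intro m
  induction m using Nat.strong_induction_on with
  | _ m ih =>
  intro a hab h3
  rcases (show m = 0 ∨ m = 1 ∨ m = 2 ∨ 3 ≤ m by omega) with rfl | rfl | rfl | hm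
  · rw [Finset.Ico_eq_empty (by omega)]; simp; omega
  · rw [sum_Ico_head f (by omega), Finset.Ico_eq_empty (by omega)]
    have := hf a
    simp only [Finset.sum_empty]
    omega
  · rw [sum_Ico_head f (by omega), sum_Ico_head f (by omega), Finset.Ico_eq_empty (by omega)]
    have := hf a
    have := hf (a + 1)
    simp only [Finset.sum_empty]
    omega
  · rw [sum_Ico_head f (by omega), sum_Ico_head f (by omega), sum_Ico_head f (by omega),
      add_assoc a 1 1, add_assoc a _ 1]
    norm_num
    have h1 := ih (m - 3) (by omega) (a := a + 3) (by omega)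
      fun i h4 h5 => h3 i (by omega) h5
    have h2 := h3 a le_rfl (by omega)
    omega

theorem three_mul_sum_le' (hf : ∀ i, 0 ≤ f i ∧ f i ≤ 1) {a b : ℤ} (hab : a ≤ b)
    (h3 : ∀ i, a ≤ i → i + 3 ≤ b → f i + f (i + 1) + f (i + 2) ≤ 2) :
    3 * ∑ i ∈ Finset.Ico a b, f i ≤ 2 * (b - a) + 2 :=
  three_mul_sum_le hf (b - a).toNat (by omega) h3

/-- Splitting off an end pair of sum at most 1 costs 3 where the general rate allows 4; each such
end saves one unit of slack. -/
theorem three_mul_sum_le_of_last (hf : ∀ i, 0 ≤ f i ∧ f i ≤ 1) {a b : ℤ} (hab : a + 2 ≤ b)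
    (h3 : ∀ i, a ≤ i → i + 3 ≤ b → f i + f (i + 1) + f (i + 2) ≤ 2)
    (hlast : f (b - 2) + f (b - 1) ≤ 1) :
    3 * ∑ i ∈ Finset.Ico a b, f i ≤ 2 * (b - a) + 1 := by
  rw [sum_Ico_last f (by omega), sum_Ico_last f (by omega), show b - 1 - 1 = b - 2 by ring]
  have := three_mul_sum_le' hf (a := a) (b := b - 2) (by omega) fun i h1 h2 => h3 i h1 (by omega)
  omega

theorem three_mul_sum_le_of_head (hf : ∀ i, 0 ≤ f i ∧ f i ≤ 1) {a b : ℤ} (hab : a + 2 ≤ b)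
    (h3 : ∀ i, a ≤ i → i + 3 ≤ b → f i + f (i + 1) + f (i + 2) ≤ 2)
    (hhead : f a + f (a + 1) ≤ 1) :
    3 * ∑ i ∈ Finset.Ico a b, f i ≤ 2 * (b - a) + 1 := by
  rw [sum_Ico_head f (by omega), sum_Ico_head f (by omega)]
  have := three_mul_sum_le' hf (a := a + 1 + 1) (b := b) (by omega)
    fun i h1 h2 => h3 i (by omega) h2
  omega

theorem three_mul_sum_le_of_head_of_last (hf : ∀ i, 0 ≤ f i ∧ f i ≤ 1) {a b : ℤ} (hab : a + 2 ≤ b)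
    (h3 : ∀ i, a ≤ i → i + 3 ≤ b → f i + f (i + 1) + f (i + 2) ≤ 2)
    (hhead : f a + f (a + 1) ≤ 1) (hlast : f (b - 2) + f (b - 1) ≤ 1) :
    3 * ∑ i ∈ Finset.Ico a b, f i ≤ 2 * (b - a) := by
  rw [sum_Ico_head f (by omega), sum_Ico_head f (by omega)]
  rcases (show b = a + 2 ∨ b = a + 3 ∨ a + 4 ≤ b by omega) with rfl | rfl | h4
  · rw [Finset.Ico_eq_empty (by omega)]
    simp only [Finset.sum_empty]
    omega
  · rw [sum_Ico_head f (by omega), Finset.Ico_eq_empty (by omega)]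
    simp only [Finset.sum_empty]
    have := hf a
    rw [show a + 3 - 2 = a + 1 by ring, show a + 3 - 1 = a + 1 + 1 by ring] at hlast
    omega
  · rw [sum_Ico_last f (by omega), sum_Ico_last f (by omega), show b - 1 - 1 = b - 2 by ring]
    have := three_mul_sum_le' hf (a := a + 1 + 1) (b := b - 2) (by omega)
      fun i h1 h2 => h3 i (by omega) (by omega)
    omega

end Sums

/-! ### Distances measured from the hub -/

namespace IsHubLabelling

open IsStripedPolygon

variable {V : Type*} {G : SimpleGraph V} {n k : ℤ} {p : ℤ → V}

theorem one_lt (h : IsHubLabelling G n p k) : 1 < n := by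
  have := h.three_le; have := h.le; omega

theorem conn (h : IsHubLabelling G n p k) : G.Connected := h.connected h.one_lt

/-- A walk from an inner fan vertex to the far part leaves the fan through the hub or through `p k`,
and `p k` is itself adjacent to the hub. -/
theorem dist_zero_le (h : IsHubLabelling G n p k) {i j : ℤ} (hi : 1 ≤ i) (hik : i < k)
    (hj : k ≤ j) (hjn : j < n) : G.dist (p 0) (p j) ≤ G.dist (p i) (p j) := by
  have key : ∀ {u v : V} (w : G.Walk u v), v = p j → ∀ i, 1 ≤ i → i < k → u = p i →
      G.dist (p 0) (p j) ≤ w.length := by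
    intro u v w
    induction w with
    | nil =>
      rintro rfl i h1 h2 h3
      exact absurd h3.symm (h.ne_of_lt (by omega) (by omega))
    | cons hadj w' ih =>
      rintro rfl i h1 h2 rfl
      rename_i u'
      rw [SimpleGraph.Walk.length_cons]
      have hn := h.one_lt
      have hk := h.le
      obtain ⟨i', h3, h4, rfl⟩ := h.exists_label (by omega) 0 u'
      have h5 := SimpleGraph.dist_le w'
      rw [zero_add] at h4
      rcases h.eq_of_adj h1 h2 h3 h4 hadj with rfl | h6
      · omega
      · rcases (show i' = 0 ∨ i' = k ∨ (1 ≤ i' ∧ i' < k) by omega) with rfl | rfl | ⟨h7, h8⟩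
        · omega
        · have := dist_le_succ_of_adj h.conn (v := p j) (h.adj_zero i' (by omega) le_rfl)
          omega
        · have := ih rfl i' h7 h8 rfl
          omega
  obtain ⟨w, hw⟩ := h.conn.exists_walk_length_eq_dist (p i) (p j)
  rw [← hw]
  exact key w rfl i hi hik rfl

/-- The first step leads to the hub or to a fan vertex before `p k`, which is no nearer to the
target. The index `k - 1` is excluded, since `p (k - 1)` can go through `p k` directly. -/
theorem dist_eq_dist_zero_add_one (h : IsHubLabelling G n p k) {i j : ℤ} (hi : 1 ≤ i)
    (hik : i + 2 ≤ k) (hj : k ≤ j) (hjn : j < n) :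
    G.dist (p i) (p j) = G.dist (p 0) (p j) + 1 := by
  have hk := h.le
  refine le_antisymm
    (dist_le_succ_of_adj h.conn (h.adj_zero i hi (by omega)).symm) ?_
  obtain ⟨y, h1, h2⟩ := exists_adj_dist_eq h.conn (h.ne_of_lt (i := i) (j := j) (by omega) (by omega))
  obtain ⟨i', h3, h4, rfl⟩ := h.exists_label (by omega) 0 y
  rw [h2]
  gcongr
  rcases (show i' = 0 ∨ (1 ≤ i' ∧ i' < k) by
    have := h.eq_of_adj hi (by omega) h3 (by omega) h1; omega) with rfl | ⟨h5, h6⟩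
  · exact le_rfl
  · exact h.dist_zero_le h5 h6 hj hjn

theorem dist_zero_eq (h : IsHubLabelling G n p k) {j : ℤ} (hj : k ≤ j) (hjn : j < n) :
    G.dist (p 0) (p j) = G.dist (p k) (p j) + 1 ∨
      G.dist (p 0) (p j) = G.dist (p (n - 1)) (p j) + 1 := by
  have hk := h.three_le
  obtain ⟨y, h1, h2⟩ := exists_adj_dist_eq h.conn (h.ne_of_lt (i := 0) (j := j) (by omega) (by omega))
  obtain ⟨i, h3, h4, rfl⟩ := h.exists_label (by omega) 0 y
  obtain ⟨h5, h6⟩ := (h.adj_zero_iff h3 (by omega)).1 h1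
  rcases (show i < k ∨ i = k ∨ i = n - 1 by omega) with h7 | rfl | rfl
  · have := h.dist_zero_le h5 h7 hj hjn
    omega
  · exact Or.inl h2
  · exact Or.inr h2

theorem dist_zero_of_lt (h : IsHubLabelling G n p k) {j : ℤ} (hj : k < j) (hjn : j + 1 < n)
    {i : ℤ} (hi : G.Adj (p 0) (p i)) (hij : G.Adj (p i) (p j)) : G.dist (p 0) (p j) = 2 := by
  have := h.three_le
  exact dist_eq_two h.conn (h.ne_of_lt (by omega) (by omega)) (h.not_adj_zero j hj hjn) hi hij

variable {R : Finset V}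

/-- The hub is on a geodesic from `p 1` to every vertex other than `p 0`, `p 1`, `p 2`, and a set of
four vertices contains such a vertex. -/
theorem zero_notMem (h : IsHubLabelling G n p k) (hR : IsGeneralPosition G R) (h4 : 4 ≤ R.card)
    (h1 : p 1 ∈ R) : p 0 ∉ R := by
  classical
  intro h0
  have hk := h.three_le
  have hkn := h.le
  obtain ⟨w, hw, hw'⟩ : ∃ w ∈ R, w ∉ ({p 0, p 1, p 2} : Finset V) := by
    apply Finset.exists_mem_notMem_of_card_lt_card
    exact lt_of_le_of_lt Finset.card_le_three h4
  simp only [Finset.mem_insert, Finset.mem_singleton, not_or] at hw'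
  obtain ⟨hw0, hw1, hw2⟩ := hw'
  obtain ⟨j, hj, hjn, rfl⟩ := h.exists_label (by omega) 0 w
  have hj0 : j ≠ 0 := by rintro rfl; exact hw0 rfl
  have hj1 : j ≠ 1 := by rintro rfl; exact hw1 rfl
  have hj2 : j ≠ 2 := by rintro rfl; exact hw2 rfl
  have a01 := (h.adj_zero 1 le_rfl (by omega)).symm
  refine hR.dist_add_dist_ne h.conn h1 h0 hw a01.ne (Ne.symm hw0) (Ne.symm hw1) ?_
  rw [SimpleGraph.dist_eq_one_iff_adj.2 a01]
  by_cases hjk : j < k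
  · have a0j := h.adj_zero j (by omega) hjk.le
    rw [SimpleGraph.dist_eq_one_iff_adj.2 a0j, dist_eq_two h.conn (Ne.symm hw1) _ a01 a0j]
    intro hadj
    have := h.eq_of_adj le_rfl (by omega) hj (by omega) hadj
    omega
  · rw [h.dist_eq_dist_zero_add_one le_rfl (by omega) (by omega) (by omega), add_comm]

/-- `p 1, p 0, p (n - 1), p (n - 2)` is a geodesic, as `k + 3 ≤ n` keeps `p (n - 2)` away from the
hub. -/
theorem not_mem_last_two (h : IsHubLabelling G n p k) (hkn : k + 3 ≤ n)
    (hR : IsGeneralPosition G R) (h1 : p 1 ∈ R) (h2 : p (n - 1) ∈ R) : p (n - 2) ∉ R := by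
  intro h3
  have hk := h.three_le
  have a := h.adj_pred h.one_lt (n - 1)
  rw [show n - 1 - 1 = n - 2 by ring] at a
  refine hR.dist_add_dist_ne h.conn h1 h2 h3 (h.ne_of_lt (by omega) (by omega)) a.symm.ne
    (h.ne_of_lt (by omega) (by omega)) ?_
  rw [h.dist_eq_dist_zero_add_one le_rfl (by omega) (by omega) (by omega),
    h.dist_eq_dist_zero_add_one le_rfl (by omega) (by omega) (by omega),
    SimpleGraph.dist_eq_one_iff_adj.2 a.symm, SimpleGraph.dist_eq_one_iff_adj.2 h.adj_zero_last,
    h.dist_zero_of_lt (by omega) (by omega) h.adj_zero_last a.symm]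

/-- If the vertex `p (n - 1)` is in the set and on a geodesic from `p 0` to `z`, so is it on one
from `p 1`. -/
theorem dist_zero_ne (h : IsHubLabelling G n p k) (hR : IsGeneralPosition G R) (h1 : p 1 ∈ R)
    {i j : ℤ} (hi : i = k ∨ i = n - 1) (hiR : p i ∈ R) (hj : k < j) (hjn : j < n) (hij : i ≠ j)
    (hjR : p j ∈ R) : G.dist (p 0) (p j) ≠ G.dist (p i) (p j) + 1 := by
  intro he
  have hk := h.three_le
  have hkn := h.le
  have hik : k ≤ i ∧ i < n := by omega
  have a0i : G.Adj (p 0) (p i) := (h.adj_zero_iff (by omega) (by omega)).2 (by omega)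
  refine hR.dist_add_dist_ne h.conn h1 hiR hjR (h.ne_of_lt (by omega) (by omega)) ?_
    (h.ne_of_lt (by omega) (by omega)) ?_
  · rcases lt_or_gt_of_ne hij with h2 | h2
    · exact h.ne_of_lt h2 (by omega)
    · exact (h.ne_of_lt h2 (by omega)).symm
  · rw [h.dist_eq_dist_zero_add_one le_rfl (by omega) hik.1 hik.2,
      h.dist_eq_dist_zero_add_one le_rfl (by omega) (by omega) (by omega),
      SimpleGraph.dist_eq_one_iff_adj.2 a0i]
    omega

theorem sum_eq (h : IsHubLabelling G n p k) (R : Finset V) :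
    (R.card : ℤ) = indicator p R 0 + ∑ i ∈ Finset.Ico 1 k, indicator p R i + indicator p R k +
      ∑ i ∈ Finset.Ico (k + 1) n, indicator p R i := by
  have hk := h.three_le
  have hkn := h.le
  have := h.sum_indicator (by omega) R 0
  rw [← this, zero_add, sum_Ico_head _ (by omega), sum_Ico_split _ (b := k) (by omega) (by omega),
    sum_Ico_head _ (show k < n by omega)]
  simp only [zero_add]
  ring

end IsHubLabelling

/-! ### Counting along the boundary when two ears are missed -/

namespace IsStripedPolygon

variable {V : Type*} {G : SimpleGraph V} {n : ℤ} {p : ℤ → V} {R : Finset V}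

theorem indicator_add_add_le (h : IsStripedPolygon G n p) (hn : 1 < n) (hR : IsGeneralPosition G R)
    (h4 : 4 ≤ R.card) {a b c : ℤ} (hac : p a ≠ p c) (hab : G.Adj (p a) (p b))
    (hbc : G.Adj (p b) (p c)) : indicator p R a + indicator p R b + indicator p R c ≤ 2 := by
  by_contra! hcon
  have hm : ∀ i, indicator p R i = 1 → p i ∈ R := by
    intro i hi
    by_contra hni
    rw [indicator_of_notMem hni] at hi
    omega
  have b0 := indicator_bounds p R a
  have b1 := indicator_bounds p R b
  have b2 := indicator_bounds p R c
  exact h.not_adj_of_adj hn hR h4 (hm a (by omega)) (hm b (by omega)) (hm c (by omega)) hac hab hbc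

theorem indicator_three (h : IsStripedPolygon G n p) (hn : 3 ≤ n) (hR : IsGeneralPosition G R)
    (h4 : 4 ≤ R.card) (i : ℤ) :
    indicator p R i + indicator p R (i + 1) + indicator p R (i + 2) ≤ 2 := by
  have a := h.adj_succ (by omega) (i + 1)
  rw [add_assoc] at a
  exact h.indicator_add_add_le (by omega) hR h4 (h.ne_of_lt (by omega) (by omega))
    (h.adj_succ (by omega) i) a

theorem sum_Ico_succ (f : ℤ → ℤ) (a b : ℤ) :
    ∑ i ∈ Finset.Ico a b, f (i + 1) = ∑ i ∈ Finset.Ico (a + 1) (b + 1), f i := by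
  refine Finset.sum_bij (fun i _ => i + 1) ?_ ?_ ?_ ?_
  · intro i hi
    simp only [Finset.mem_Ico] at hi ⊢
    omega
  · intro i _ j _ hij
    omega
  · intro i hi
    simp only [Finset.mem_Ico] at hi
    exact ⟨i - 1, by simp only [Finset.mem_Ico]; omega, by simp⟩
  · intro i _
    rfl

/-- A large general position set contains one of two ears. -/
theorem card_le_of_ears (h : IsStripedPolygon G n p) (hn : 5 ≤ n) (hR : IsGeneralPosition G R)
    (h4 : 4 ≤ R.card) (h02 : G.Adj (p 0) (p 2)) {c : ℤ} (hc2 : 2 < c) (hcn : c < n)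
    (hear : G.Adj (p (c - 1)) (p (c + 1))) (h1 : p 1 ∉ R) (hc : p c ∉ R) :
    3 * (R.card : ℤ) ≤ 2 * n - 3 := by
  set f := indicator p R with hf
  have hb := indicator_bounds p R
  have hthree := h.indicator_three (by omega) hR h4
  have htri : ∀ {a b c : ℤ}, p a ≠ p c → G.Adj (p a) (p b) → G.Adj (p b) (p c) →
      f a + f b + f c ≤ 2 := fun {a b c} => h.indicator_add_add_le (by omega) hR h4
  -- On the window from 2 to `n`, `g` runs through the cycle left after deleting both ears. Their
  -- chords bridge the gaps, so three cyclically consecutive entries still sum to at most 2.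
  set g : ℤ → ℤ := fun i => if i < c then f i else f (i + 1) with hg
  have g1 : ∀ i, i < c → g i = f i := fun i hi => if_pos hi
  have g2 : ∀ i, c ≤ i → g i = f (i + 1) := fun i hi => if_neg (by omega)
  have hgb : ∀ i, 0 ≤ g i ∧ g i ≤ 1 := by
    intro i
    rcases lt_or_ge i c with h5 | h5
    · rw [g1 i h5]; exact hb i
    · rw [g2 i h5]; exact hb _
  have hsum : (R.card : ℤ) = ∑ i ∈ Finset.Ico 2 n, g i := by
    have e1 := h.sum_indicator (by omega) R 1
    rw [sum_Ico_head _ (by omega), sum_Ico_split _ (b := c) (by omega) (by omega),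
      sum_Ico_head _ (show c < 1 + n by omega), indicator_of_notMem h1, indicator_of_notMem hc,
      add_comm 1 n] at e1
    rw [sum_Ico_split _ (b := c) (by omega) (by omega), ← e1]
    rw [Finset.sum_congr rfl (g := f) fun i hi => g1 i (Finset.mem_Ico.1 hi).2,
      Finset.sum_congr (s₁ := Finset.Ico c n) rfl (g := fun i => f (i + 1))
        fun i hi => g2 i (Finset.mem_Ico.1 hi).1, sum_Ico_succ, zero_add, zero_add]
    rfl
  have hg3 : ∀ i, 2 ≤ i → i + 3 ≤ n → g i + g (i + 1) + g (i + 2) ≤ 2 := by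
    intro i h5 h6
    rcases (show i + 2 < c ∨ i + 2 = c ∨ i + 1 = c ∨ c ≤ i by omega) with h7 | h7 | h7 | h7
    · rw [g1 _ (by omega), g1 _ (by omega), g1 _ (by omega)]
      exact hthree i
    · rw [g1 _ (by omega), g1 _ (by omega), g2 _ (by omega)]
      refine htri (h.ne_of_lt (by omega) (by omega)) (h.adj_succ (by omega) i) ?_
      rwa [show i + 1 = c - 1 by omega, h7]
    · rw [g1 _ (by omega), g2 _ (by omega), g2 _ (by omega)]
      refine htri (h.ne_of_lt (by omega) (by omega)) ?_ ?_
      · rwa [h7, show i = c - 1 by omega]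
      · have := h.adj_succ (by omega) (i + 1 + 1)
        rwa [show i + 1 + 1 + 1 = i + 2 + 1 by ring] at this
    · rw [g2 _ (by omega), g2 _ (by omega), g2 _ (by omega)]
      have := hthree (i + 1)
      rwa [show i + 1 + 2 = i + 2 + 1 by ring] at this
  have hwrap : g (n - 2) + g (n - 1) + g 2 ≤ 2 := by
    rw [g1 2 hc2, g2 (n - 1) (by omega), sub_add_cancel]
    have e := h.apply_period
    have e2 : G.Adj (p n) (p 2) := by rw [e]; exact h02
    rcases (show c = n - 1 ∨ c ≤ n - 2 by omega) with rfl | h5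
    · rw [g1 _ (by omega)]
      refine htri (h.ne_of_lt (i := 2) (j := n - 2) (by omega) (by omega)).symm ?_ e2
      ring_nf at hear ⊢
      exact hear
    · rw [g2 _ (by omega)]
      refine htri (h.ne_of_lt (i := 2) (j := n - 2 + 1) (by omega) (by omega)).symm ?_ e2
      have := h.adj_succ (by omega) (n - 1)
      ring_nf at this ⊢
      exact this
  rw [hsum]
  -- By the wrap-around triple, if the last two entries are both 1 then the entry at 2 is 0; so one
  -- end pair always saves a unit.
  by_cases hl : g (n - 2) + g (n - 1) ≤ 1
  · have := three_mul_sum_le_of_last hgb (a := 2) (b := n) (by omega) hg3 hl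
    omega
  · have b1 := hgb 2
    have b2 := hgb (2 + 1)
    have := three_mul_sum_le_of_head hgb (a := 2) (b := n) (by omega) hg3 (by omega)
    omega

end IsStripedPolygon

/-! ### The upper bound when the set contains an ear -/

namespace IsHubLabelling

open IsStripedPolygon

variable {V : Type*} {G : SimpleGraph V} {n k : ℤ} {p : ℤ → V} {R : Finset V}

theorem sum_eq_zero {a b : ℤ} (h : ∀ j, a ≤ j → j < b → p j ∉ R) :
    ∑ i ∈ Finset.Ico a b, indicator p R i = 0 :=
  Finset.sum_eq_zero fun i hi => indicator_of_notMem
    (h i (Finset.mem_Ico.1 hi).1 (Finset.mem_Ico.1 hi).2)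

/-- With `p 1` and `p k` in the set, vertices whose geodesic from the hub starts with `p k` are
forbidden. If `p (n - 1)` is also chosen, nothing strictly between `p k` and `p (n - 1)` can be,
which gives `3|R| ≤ 2k + 4` and forces `n = k + 3`. If it is not chosen, the count stays below `2n -
2`. -/
theorem card_of_mem (h : IsHubLabelling G n p k) (hkn : k + 3 ≤ n)
    (hR : IsGeneralPosition G R) (h4 : 4 ≤ R.card) (h1 : p 1 ∈ R)
    (hbig : 2 * n - 2 ≤ 3 * (R.card : ℤ)) (hk : p k ∈ R) :
    3 * (R.card : ℤ) = 2 * n - 2 ∧ n = k + 3 := by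
  have hk3 := h.three_le
  have hb := indicator_bounds p R
  have hthree := h.indicator_three (by omega) hR h4
  have hsum := h.sum_eq R
  rw [indicator_of_notMem (h.zero_notMem hR h4 h1), indicator_of_mem hk] at hsum
  have hk1 : p (k + 1) ∉ R := by
    intro hk1
    refine h.dist_zero_ne hR h1 (Or.inl rfl) hk (by omega) (by omega) (by omega) hk1 ?_
    rw [h.dist_zero_of_lt (by omega) (by omega) (h.adj_zero k (by omega) le_rfl)
      (h.adj_succ h.one_lt k), SimpleGraph.dist_eq_one_iff_adj.2 (h.adj_succ h.one_lt k)]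
  rw [sum_Ico_head _ (show k + 1 < n by omega), indicator_of_notMem hk1,
    sum_Ico_last _ (show k + 1 + 1 < n by omega)] at hsum
  by_cases hl : p (n - 1) ∈ R
  · have hzero : ∀ j, k + 1 + 1 ≤ j → j < n - 1 → p j ∉ R := by
      intro j h5 h6 hj
      rcases h.dist_zero_eq (j := j) (by omega) (by omega) with h7 | h7
      · exact h.dist_zero_ne hR h1 (Or.inl rfl) hk (by omega) (by omega) (by omega) hj h7
      · exact h.dist_zero_ne hR h1 (Or.inr rfl) hl (by omega) (by omega) (by omega) hj h7
    have hkm : p (k - 1) ∉ R := by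
      intro hkm
      exact h.not_adj_of_adj h.one_lt hR h4 hkm hk hl (h.ne_of_lt (by omega) (by omega))
        (h.adj_pred h.one_lt k) h.adj_last
    rw [sum_eq_zero hzero, indicator_of_mem hl, sum_Ico_last _ (show 1 < k by omega),
      indicator_of_notMem hkm] at hsum
    have := three_mul_sum_le' hb (a := 1) (b := k - 1) (by omega) fun i _ _ => hthree i
    omega
  · exfalso
    rw [indicator_of_notMem hl] at hsum
    by_cases hkm : p (k - 1) ∈ R
    · have hleft := three_mul_sum_le' hb (a := 1) (b := k + 1) (by omega) fun i _ _ => hthree i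
      rw [sum_Ico_last _ (show 1 < k + 1 by omega), add_sub_cancel_right,
        indicator_of_mem hk] at hleft
      by_cases hn3 : n = k + 3
      · rw [Finset.Ico_eq_empty (a := k + 1 + 1) (b := n - 1) (by omega)] at hsum
        simp only [Finset.sum_empty] at hsum
        omega
      · have hk2 : p (k + 2) ∉ R := by
          intro hk2
          have n1 := h.ne_of_lt (i := k - 1) (j := k + 2) (by omega) (by omega)
          have a1 := h.adj_pred h.one_lt k
          by_cases hadj : G.Adj (p k) (p (k + 2))
          · exact h.not_adj_of_adj h.one_lt hR h4 hkm hk hk2 n1 a1 hadj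
          · have n2 := h.ne_of_lt (i := k) (j := k + 2) (by omega) (by omega)
            have a2 := h.adj_succ h.one_lt k
            have a3 := h.adj_succ h.one_lt (k + 1)
            rw [show k + 1 + 1 = k + 2 by ring] at a3
            have d1 := dist_eq_two h.conn n2 hadj a2 a3
            have d2 : 3 ≤ G.dist (p (k - 1)) (p (k + 2)) := by
              refine three_le_dist h.conn n1 ?_ ?_
              · intro hc
                have := h.eq_of_adj (by omega) (by omega) (by omega) (by omega) hc
                omega
              · intro y hy hy'
                obtain ⟨i, h5, h6, rfl⟩ := h.exists_label (by omega) 0 y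
                rcases h.eq_of_adj (by omega) (by omega) h5 (by omega) hy with rfl | h7 | h7
                · exact h.not_adj_zero _ (by omega) (by omega) hy'
                · have := h.eq_of_adj (by omega) (by omega) (by omega) (by omega) hy'
                  omega
                · rw [h7, sub_add_cancel] at hy'
                  exact hadj hy'
            have d3 := SimpleGraph.dist_eq_one_iff_adj.2 a1
            have d4 := h.conn.dist_triangle (u := p (k - 1)) (v := p k) (w := p (k + 2))
            exact hR.dist_add_dist_ne h.conn hkm hk hk2 a1.ne n2 n1 (by omega)
        rw [sum_Ico_head _ (show k + 1 + 1 < n - 1 by omega), show k + 1 + 1 = k + 2 by ring,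
          indicator_of_notMem hk2] at hsum
        have := three_mul_sum_le' hb (a := k + 2 + 1) (b := n - 1) (by omega) fun i _ _ => hthree i
        omega
    · rw [sum_Ico_last _ (show 1 < k by omega), indicator_of_notMem hkm] at hsum
      have := three_mul_sum_le' hb (a := 1) (b := k - 1) (by omega) fun i _ _ => hthree i
      have := three_mul_sum_le' hb (a := k + 1 + 1) (b := n - 1) (by omega) fun i _ _ => hthree i
      omega

/-- Were `p (k - 2)` and `p (k - 1)` both chosen, no far element could be nearer to `p k` than to
the hub: `p (k - 1)` would be on a geodesic from `p (k - 2)` to it. This leaves too few far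
vertices. -/
theorem left_not_mem (h : IsHubLabelling G n p k) (hkn : k + 3 ≤ n)
    (hR : IsGeneralPosition G R) (h4 : 4 ≤ R.card) (h1 : p 1 ∈ R)
    (hbig : 2 * n - 2 ≤ 3 * (R.card : ℤ)) (hk : p k ∉ R) (hk2 : p (k - 2) ∈ R) :
    p (k - 1) ∉ R := by
  intro hk1
  have hk3 := h.three_le
  have hb := indicator_bounds p R
  have hthree := h.indicator_three (by omega) hR h4
  have hsum := h.sum_eq R
  rw [indicator_of_notMem (h.zero_notMem hR h4 h1), indicator_of_notMem hk] at hsum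
  have hle : ∀ j, k < j → j < n → p j ∈ R → G.dist (p 0) (p j) ≤ G.dist (p k) (p j) := by
    intro j h5 h6 hj
    by_contra! hlt
    have d1 := h.dist_eq_dist_zero_add_one (i := k - 2) (j := j) (by omega) (by omega) (by omega) h6
    have a1 := h.adj_pred h.one_lt (k - 1)
    have a2 := h.adj_pred h.one_lt k
    rw [show k - 1 - 1 = k - 2 by ring] at a1
    have d2 := dist_le_succ_of_adj h.conn (v := p j) a1
    have d3 := dist_le_succ_of_adj h.conn (v := p j) a2
    refine hR.dist_add_dist_ne h.conn hk2 hk1 hj a1.ne (h.ne_of_lt (by omega) (by omega))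
      (h.ne_of_lt (by omega) (by omega)) ?_
    rw [SimpleGraph.dist_eq_one_iff_adj.2 a1]
    omega
  have hk1' : p (k + 1) ∉ R := by
    intro h5
    have := hle (k + 1) (by omega) (by omega) h5
    rw [h.dist_zero_of_lt (by omega) (by omega) (h.adj_zero k (by omega) le_rfl)
      (h.adj_succ h.one_lt k), SimpleGraph.dist_eq_one_iff_adj.2 (h.adj_succ h.one_lt k)] at this
    omega
  rw [sum_Ico_head _ (show k + 1 < n by omega), indicator_of_notMem hk1',
    sum_Ico_last _ (show k + 1 + 1 < n by omega)] at hsum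
  have hleft := three_mul_sum_le' hb (a := 1) (b := k) (by omega) fun i _ _ => hthree i
  by_cases hl : p (n - 1) ∈ R
  · have hzero : ∀ j, k + 1 + 1 ≤ j → j < n - 1 → p j ∉ R := by
      intro j h5 h6 hj
      have h8 := hle j (by omega) (by omega) hj
      rcases h.dist_zero_eq (j := j) (by omega) (by omega) with h7 | h7
      · omega
      · exact h.dist_zero_ne hR h1 (Or.inr rfl) hl (by omega) (by omega) (by omega) hj h7
    rw [sum_eq_zero hzero, indicator_of_mem hl] at hsum
    omega
  · rw [indicator_of_notMem hl] at hsum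
    have := three_mul_sum_le' hb (a := k + 1 + 1) (b := n - 1) (by omega) fun i _ _ => hthree i
    omega

/-- Each triangle beyond `p k p j` has apex `p (j + 1)` or `p (k - 1)`, and the latter has no
neighbours that far, so the fan at `p k` grows step by step. -/
theorem adj_of_adj_two (h : IsHubLabelling G n p k) (hadj : G.Adj (p k) (p (k + 2))) :
    ∀ j, k < j → j < n → G.Adj (p k) (p j) := by
  have hk3 := h.three_le
  have key : ∀ m : ℕ, k + 2 + m < n → G.Adj (p k) (p (k + 2 + m)) := by
    intro m
    induction m with
    | zero => intro _; simpa using hadj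
    | succ m ih =>
      intro hm
      push_cast at hm ⊢
      have a := ih (by omega)
      have e := h.apply_add k
      obtain ⟨c, h1, h2, h3, h5⟩ := h.exists_triangle (a := k + 2 + m) (b := k + n) (by omega)
        (by omega) (by rw [e]; exact a.symm)
      rcases h.striped _ _ _ h1 h2 (by omega) h3 h5 (by rw [e]; exact a.symm) with rfl | h6 | h6
      · rw [e] at h5
        rw [← add_assoc]
        exact h5.symm
      · have e' := h.apply_add (k - 1)
        rw [show k - 1 + n = c by omega] at e'
        rw [e'] at h3
        have := h.eq_of_adj (by omega) (by omega) (by omega) (by omega) h3.symm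
        omega
      · omega
  intro j h1 h2
  rcases (show j = k + 1 ∨ k + 2 ≤ j by omega) with rfl | h3
  · exact h.adj_succ h.one_lt k
  · have := key (j - k - 2).toNat (by omega)
    rwa [show k + 2 + ((j - k - 2).toNat : ℤ) = j by omega] at this

/-- The fan part satisfies `3·sum ≤ 2k - 1` and the far part `3·sum ≤ 2(n - k) - 1`, together `2n -
2`, so both are tight. Tightness on the left gives `3 ∣ k + 1`; on the right it puts `p (k + 1)`, `p
(k + 2)` and `p (n - 1)` into the set, and then `p k` must be adjacent to `p (k + 2)`. -/
theorem card_of_notMem (h : IsHubLabelling G n p k) (hkn : k + 3 ≤ n)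
    (hR : IsGeneralPosition G R) (h4 : 4 ≤ R.card) (h1 : p 1 ∈ R)
    (hbig : 2 * n - 2 ≤ 3 * (R.card : ℤ)) (hk : p k ∉ R) :
    3 * (R.card : ℤ) = 2 * n - 2 ∧ 3 ∣ k + 1 ∧ ∀ j, k < j → j < n → G.Adj (p k) (p j) := by
  have hk3 := h.three_le
  have hb := indicator_bounds p R
  have hthree := h.indicator_three (by omega) hR h4
  have hsum := h.sum_eq R
  rw [indicator_of_notMem (h.zero_notMem hR h4 h1), indicator_of_notMem hk] at hsum
  have htwo : ∀ i j, (p i ∈ R → p j ∉ R) → indicator p R i + indicator p R j ≤ 1 := by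
    intro i j hij
    have := hb i
    have := hb j
    by_cases hi : p i ∈ R
    · rw [indicator_of_notMem (hij hi)]; omega
    · rw [indicator_of_notMem hi]; omega
  have hleft := three_mul_sum_le_of_last hb (a := 1) (b := k) (by omega) (fun i _ _ => hthree i)
    (htwo _ _ (h.left_not_mem hkn hR h4 h1 hbig hk))
  have hlast : indicator p R (n - 2) + indicator p R (n - 1) ≤ 1 := by
    rw [add_comm]
    exact htwo _ _ (h.not_mem_last_two hkn hR h1)
  have hright := three_mul_sum_le_of_last hb (a := k + 1) (b := n) (by omega)
    (fun i _ _ => hthree i) hlast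
  have hk12 : p (k + 1) ∈ R ∧ p (k + 2) ∈ R := by
    by_contra hcon
    have := three_mul_sum_le_of_head_of_last hb (a := k + 1) (b := n) (by omega)
      (fun i _ _ => hthree i) (by
        rw [show k + 1 + 1 = k + 2 by ring]
        exact htwo _ _ fun h5 h6 => hcon ⟨h5, h6⟩) hlast
    omega
  obtain ⟨hk1, hk2⟩ := hk12
  have hn4 : k + 4 ≤ n := by
    by_contra hcon
    refine h.not_mem_last_two hkn hR h1 ?_ ?_
    · rwa [show n - 1 = k + 2 by omega]
    · rwa [show n - 2 = k + 1 by omega]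
  have hn1 : p (n - 1) ∈ R := by
    by_contra hcon
    rw [sum_Ico_last _ (show k + 1 < n by omega), indicator_of_notMem hcon] at hsum
    have := three_mul_sum_le' hb (a := k + 1) (b := n - 1) (by omega) fun i _ _ => hthree i
    omega
  have hadj : G.Adj (p k) (p (k + 2)) := by
    by_contra hnadj
    have a1 := h.adj_succ h.one_lt (k + 1)
    rw [show k + 1 + 1 = k + 2 by ring] at a1
    have a0 := h.adj_succ h.one_lt k
    by_cases hc : G.Adj (p (n - 1)) (p (k + 2))
    · exact h.not_adj_of_adj h.one_lt hR h4 hk1 hk2 hn1 (h.ne_of_lt (by omega) (by omega)) a1 hc.symm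
    · have d1 : 3 ≤ G.dist (p 0) (p (k + 2)) := by
        refine three_le_dist h.conn (h.ne_of_lt (by omega) (by omega))
          (h.not_adj_zero _ (by omega) (by omega)) ?_
        intro y hy hy'
        obtain ⟨i, h5, h6, rfl⟩ := h.exists_label (by omega) 0 y
        obtain ⟨h7, h8⟩ := (h.adj_zero_iff h5 (by omega)).1 hy
        rcases (show i < k ∨ i = k ∨ i = n - 1 by omega) with h9 | rfl | rfl
        · have := h.eq_of_adj h7 h9 (by omega) (by omega) hy'
          omega
        · exact hnadj hy'
        · exact hc hy'
      have d2 := h.dist_zero_of_lt (j := k + 1) (by omega) (by omega)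
        (h.adj_zero k (by omega) le_rfl) a0
      have d3 := h.conn.dist_triangle (u := p 0) (v := p (k + 1)) (w := p (k + 2))
      have d4 := SimpleGraph.dist_eq_one_iff_adj.2 a1
      refine hR.dist_add_dist_ne h.conn h1 hk1 hk2 (h.ne_of_lt (by omega) (by omega)) a1.ne
        (h.ne_of_lt (by omega) (by omega)) ?_
      rw [h.dist_eq_dist_zero_add_one le_rfl (by omega) (by omega) (by omega),
        h.dist_eq_dist_zero_add_one le_rfl (by omega) (by omega) (by omega)]
      omega
  have hmod : 3 * ∑ i ∈ Finset.Ico 1 k, indicator p R i = 2 * k - 1 := by omega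
  exact ⟨by omega, by omega, h.adj_of_adj_two hadj⟩

/-- The hub is adjacent to everything, so with any two further elements it would give a connected
triple; the other `n - 1` vertices form a path. -/
theorem card_of_fan (h : IsHubLabelling G n p k) (hkn : k + 2 = n)
    (hR : IsGeneralPosition G R) (h4 : 4 ≤ R.card) : 3 * (R.card : ℤ) ≤ 2 * n := by
  classical
  have hk3 := h.three_le
  have hb := indicator_bounds p R
  have hthree := h.indicator_three (by omega) hR h4
  have h0 : p 0 ∉ R := by
    intro h0
    obtain ⟨x, hx, hx'⟩ : ∃ w ∈ R, w ∉ ({p 0} : Finset V) :=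
      Finset.exists_mem_notMem_of_card_lt_card (by rw [Finset.card_singleton]; omega)
    obtain ⟨y, hy, hy'⟩ : ∃ w ∈ R, w ∉ ({p 0, x} : Finset V) :=
      Finset.exists_mem_notMem_of_card_lt_card (lt_of_le_of_lt Finset.card_le_two (by omega))
    simp only [Finset.mem_insert, Finset.mem_singleton, not_or] at hx' hy'
    have key : ∀ z, z ≠ p 0 → G.Adj (p 0) z := by
      intro z hz
      obtain ⟨i, h5, h6, rfl⟩ := h.exists_label (by omega) 0 z
      have : i ≠ 0 := by rintro rfl; exact hz rfl
      exact (h.adj_zero_iff h5 (by omega)).2 ⟨by omega, by omega⟩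
    exact h.not_adj_of_adj h.one_lt hR h4 hx h0 hy (Ne.symm hy'.2) (key x hx').symm (key y hy'.1)
  have hsum := h.sum_indicator (by omega) R 0
  rw [zero_add, sum_Ico_head _ (by omega), indicator_of_notMem h0] at hsum
  have := three_mul_sum_le' hb (a := 0 + 1) (b := n) (by omega) fun i _ _ => hthree i
  omega

end IsHubLabelling

/-- The structure of a striped polygon with a large general position set. -/
theorem IsStripedPolygon.exists_hub_of_card {V : Type*} {G : SimpleGraph V} {n : ℤ} {p : ℤ → V}
    {R : Finset V} (h : IsStripedPolygon G n p) (hn : 5 ≤ n) (hR : IsGeneralPosition G R)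
    (h4 : 4 ≤ R.card) (hbig : 2 * n - 2 ≤ 3 * (R.card : ℤ)) :
    ∃ q k, IsHubLabelling G n q k ∧ ((k + 2 = n ∧ 3 * (R.card : ℤ) ≤ 2 * n) ∨
      (3 * (R.card : ℤ) = 2 * n - 2 ∧ (n = k + 3 ∨
        (3 ∣ k + 1 ∧ ∀ j, k < j → j < n → G.Adj (q k) (q j))))) := by
  -- The chord of a first ear cuts off a second ear on its other side. A set this large cannot miss
  -- both, so the labelling may start at an ear of the set.
  obtain ⟨q, k, hq, hqR⟩ : ∃ q k, IsHubLabelling G n q k ∧ q 1 ∈ R := by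
    have a := h.adj_pred (by omega) n
    rw [h.apply_period] at a
    obtain ⟨c, -, -, hear⟩ := h.exists_ear (n - 3).toNat (a := 0) (b := n - 1) (by omega) (by omega)
      a.symm
    obtain ⟨q, k, hq, hq1⟩ := h.exists_hub hn hear
    by_cases hqR : q 1 ∈ R
    · exact ⟨q, k, hq, hqR⟩
    have a2 := hq.adj_zero 2 (by omega) (by have := hq.three_le; omega)
    obtain ⟨c', h5, h6, hear'⟩ := hq.exists_ear (n - 4).toNat (a := 2) (b := n) (by omega)
      (by omega) (by rw [hq.apply_period]; exact a2.symm)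
    by_cases hc : q c' ∈ R
    · obtain ⟨q', k', hq', hq1'⟩ := hq.exists_hub hn hear'
      exact ⟨q', k', hq', hq1' ▸ hc⟩
    · have := hq.card_le_of_ears hn hR h4 a2 h5 h6 hear' hqR hc
      omega
  refine ⟨q, k, hq, ?_⟩
  have hkn := hq.le
  by_cases hk2 : k + 2 = n
  · exact Or.inl ⟨hk2, hq.card_of_fan hk2 hR h4⟩
  · right
    by_cases hk : q k ∈ R
    · have := hq.card_of_mem (by omega) hR h4 hqR hbig hk
      exact ⟨this.1, Or.inl this.2⟩
    · have := hq.card_of_notMem (by omega) hR h4 hqR hbig hk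
      exact ⟨this.1, Or.inr this.2⟩

/-! ### Recognising the extremal graphs -/

/-- An isomorphism is given by a bijective labelling with `0, …, n - 1`; adjacency need only be
compared on increasing pairs. -/
theorem IsStripedPolygon.nonempty_iso {V W : Type*} {G : SimpleGraph V} {n : ℤ} {p : ℤ → V}
    (h : IsStripedPolygon G n p) (hn : 0 < n) {H : SimpleGraph W} (l : W → ℤ)
    (hl : ∀ w, 0 ≤ l w ∧ l w < n) (hinj : Function.Injective l)
    (hsurj : ∀ i, 0 ≤ i → i < n → ∃ w, l w = i)
    (hadj : ∀ a b, l a < l b → (G.Adj (p (l a)) (p (l b)) ↔ H.Adj a b)) :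
    Nonempty (G ≃g H) := by
  have hbij : Function.Bijective fun w => p (l w) := by
    constructor
    · intro a b hab
      by_contra hne
      rcases lt_or_gt_of_ne (hinj.ne hne) with h1 | h1
      · exact h.ne_of_lt h1 (by have := hl a; have := hl b; omega) hab
      · exact h.ne_of_lt h1 (by have := hl a; have := hl b; omega) hab.symm
    · intro v
      obtain ⟨i, h1, h2, rfl⟩ := h.exists_label hn 0 v
      obtain ⟨w, rfl⟩ := hsurj i h1 (by omega)
      exact ⟨w, rfl⟩
  refine ⟨SimpleGraph.Iso.symm ⟨Equiv.ofBijective _ hbij, ?_⟩⟩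
  intro a b
  simp only [Equiv.ofBijective_apply]
  rcases lt_trichotomy (l a) (l b) with h1 | h1 | h1
  · exact hadj a b h1
  · rw [hinj h1]
    simp
  · rw [G.adj_comm, H.adj_comm]
    exact hadj b a h1

namespace IsHubLabelling

variable {V : Type*} {G : SimpleGraph V} {k : ℤ} {p : ℤ → V}

theorem adj_iff {n : ℤ} (h : IsHubLabelling G n p k) (hk : ∀ j, k < j → j < n → G.Adj (p k) (p j))
    {i j : ℤ} (hi : 0 ≤ i) (hij : i < j) (hj : j < n) :
    G.Adj (p i) (p j) ↔ (i = 0 ∧ (j ≤ k ∨ j = n - 1)) ∨ j = i + 1 ∨ i = k := by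
  have hk3 := h.three_le
  constructor
  · intro hadj
    rcases hi.eq_or_lt with rfl | hi
    · have := (h.adj_zero_iff (by omega) hj).1 hadj
      omega
    · rcases lt_trichotomy i k with h1 | h1 | h1
      · have := h.eq_of_adj hi h1 (by omega) hj hadj
        omega
      · omega
      · by_contra hcon
        exact h.noncrossing k (i + 1) i j h1 (by omega) (by omega) (by omega)
          (hk _ (by omega) (by omega)) hadj
  · rintro (⟨rfl, h1⟩ | rfl | rfl)
    · exact (h.adj_zero_iff (by omega) hj).2 (by omega)
    · exact h.adj_succ h.one_lt i
    · exact hk j hij hj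

theorem nonempty_iso_fan {n : ℕ} (h : IsHubLabelling G n p k) (hk : k + 2 = n) :
    Nonempty (G ≃g fan (n - 1)) := by
  have hk3 := h.three_le
  have hlast : ∀ j, k < j → j < n → G.Adj (p k) (p j) := by
    intro j h1 h2
    rw [show j = k + 1 by omega]
    exact h.adj_succ h.one_lt k
  refine h.nonempty_iso (by omega) (fun w => match w with | none => 0 | some i => (i : ℤ) + 1)
    ?_ ?_ ?_ ?_
  · rintro (_ | i)
    · simp only; omega
    · have := i.2; simp only; omega
  · rintro (_ | i) (_ | j) hij
    · rfl
    · simp only at hij; omega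
    · simp only at hij; omega
    · simp only at hij
      rw [Fin.ext (show i.val = j.val by omega)]
  · intro i h1 h2
    by_cases h0 : i = 0
    · exact ⟨none, h0.symm⟩
    · exact ⟨some ⟨(i - 1).toNat, by omega⟩, by simp only; omega⟩
  · rintro (_ | i) (_ | j) hij
    · simp at hij
    · simp only at hij ⊢
      have := j.2
      rw [h.adj_iff hlast le_rfl hij (by omega)]
      simp [fan]
      omega
    · simp only at hij; omega
    · simp only at hij ⊢
      have := j.2
      rw [h.adj_iff hlast (by omega) hij (by omega)]
      simp [fan, Fin.ext_iff]
      omega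

theorem nonempty_iso_quasiFan {n : ℕ} (h : IsHubLabelling G n p k) (hk : k + 3 = n) :
    Nonempty (G ≃g quasiFan 1 n) := by
  have hk3 := h.three_le
  have hlast : ∀ j, k < j → j < n → G.Adj (p k) (p j) := by
    intro j h1 h2
    rcases (show j = k + 1 ∨ j = n - 1 by omega) with rfl | rfl
    · exact h.adj_succ h.one_lt k
    · exact h.adj_last
  -- The path at the hub, read backwards, is `p (n - 1), p k, p (k - 1), …, p 1`. The extra vertex
  -- is `p (k + 1)`, attached to its first two vertices.
  refine h.nonempty_iso (by omega) (fun w => match w with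
    | none => k + 1
    | some none => 0
    | some (some l) => if l.val = 0 then k + 2 else k + 1 - l) ?_ ?_ ?_ ?_
  · rintro (_ | _ | l)
    · simp only; omega
    · simp only; omega
    · have := l.2; simp only; split_ifs <;> omega
  · rintro (_ | _ | i) (_ | _ | j) hij
    · rfl
    · simp only at hij; omega
    · simp only at hij; split_ifs at hij <;> omega
    · simp only at hij; omega
    · rfl
    · have := j.2; simp only at hij; split_ifs at hij <;> omega
    · simp only at hij; split_ifs at hij <;> omega
    · have := i.2; simp only at hij; split_ifs at hij <;> omega
    · have : i.val = j.val := by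
        have := i.2
        have := j.2
        simp only at hij
        split_ifs at hij <;> omega
      rw [Fin.ext this]
  · intro i h1 h2
    rcases (show i = 0 ∨ i = k + 1 ∨ i = k + 2 ∨ (1 ≤ i ∧ i ≤ k) by omega) with h0 | h0 | h0 | h0
    · exact ⟨some none, h0.symm⟩
    · exact ⟨none, h0.symm⟩
    · exact ⟨some (some ⟨0, by omega⟩), by simp only; split_ifs <;> omega⟩
    · exact ⟨some (some ⟨(k + 1 - i).toNat, by omega⟩), by simp only; split_ifs <;> omega⟩
  · rintro (_ | _ | i) (_ | _ | j) hij
    · simp at hij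
    · simp only at hij; omega
    · have := j.2
      simp only at hij ⊢
      rw [h.adj_iff hlast (by omega) hij (by split_ifs <;> omega)]
      simp [quasiFan]
      split_ifs at hij ⊢ <;> omega
    · simp only at hij ⊢
      rw [h.adj_iff hlast (by omega) hij (by omega)]
      simp [quasiFan]
      omega
    · simp at hij
    · have := j.2
      simp only at hij ⊢
      rw [h.adj_iff hlast (by omega) hij (by split_ifs <;> omega)]
      simp [quasiFan, fan]
      split_ifs at hij ⊢ <;> omega
    · have := i.2
      simp only at hij ⊢
      rw [h.adj_iff hlast (by split_ifs <;> omega) hij (by omega)]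
      simp [quasiFan]
      split_ifs at hij ⊢ <;> omega
    · have := i.2
      simp only at hij; split_ifs at hij <;> omega
    · have := i.2
      have := j.2
      simp only at hij ⊢
      rw [h.adj_iff hlast (by split_ifs <;> omega) hij (by split_ifs <;> omega)]
      simp [quasiFan, fan, Fin.ext_iff]
      split_ifs at hij ⊢ <;> omega

theorem nonempty_iso_doubleFanOne {n t : ℕ} (h : IsHubLabelling G n p k) (hkt : 3 * t = k + 1)
    (hlast : ∀ j, k < j → j < n → G.Adj (p k) (p j)) :
    Nonempty (G ≃g doubleFanOne 1 t n) := by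
  have hk3 := h.three_le
  have hkn := h.le
  -- The hub path read backwards has `p k` in second place, which is the centre of the second fan.
  -- The second path descends from `p (n - 2)` to `p (k + 1)`, and its first vertex is adjacent to
  -- `p (n - 1)`.
  refine h.nonempty_iso (by omega) (fun w => match w with
    | .v => 0
    | .p l => if l.val = 0 then (n : ℤ) - 1 else k + 1 - l
    | .u l => n - 2 - l) ?_ ?_ ?_ ?_
  · rintro (_ | l | l)
    · simp only; omega
    · have := l.2; simp only; split_ifs <;> omega
    · have := l.2; simp only; omega
  · rintro (_ | i | i) (_ | j | j) hij
    · rfl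
    · have := j.2; simp only at hij; split_ifs at hij <;> omega
    · have := j.2; simp only at hij; omega
    · have := i.2; simp only at hij; split_ifs at hij <;> omega
    · have : i.val = j.val := by
        have := i.2
        have := j.2
        simp only at hij
        split_ifs at hij <;> omega
      rw [Fin.ext this]
    · have := j.2; have := i.2; simp only at hij; split_ifs at hij <;> omega
    · have := i.2; simp only at hij; omega
    · have := j.2; have := i.2; simp only at hij; split_ifs at hij <;> omega
    · have : i.val = j.val := by simp only at hij; omega
      rw [Fin.ext this]
  · intro i h1 h2
    rcases (show i = 0 ∨ (k < i ∧ i < n - 1) ∨ i = n - 1 ∨ (1 ≤ i ∧ i ≤ k) by omega)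
      with h0 | h0 | h0 | h0
    · exact ⟨.v, h0.symm⟩
    · exact ⟨.u ⟨(n - 2 - i).toNat, by omega⟩, by simp only; omega⟩
    · exact ⟨.p ⟨0, by omega⟩, by simp only; split_ifs <;> omega⟩
    · exact ⟨.p ⟨(k + 1 - i).toNat, by omega⟩, by simp only; split_ifs <;> omega⟩
  · rintro (_ | i | i) (_ | j | j) hij
    · simp at hij
    · have := j.2
      simp only at hij ⊢
      rw [h.adj_iff hlast (by omega) hij (by split_ifs <;> omega)]
      simp [doubleFanOne, doubleFan]
      split_ifs at hij ⊢ <;> omega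
    · have := j.2
      simp only at hij ⊢
      rw [h.adj_iff hlast (by omega) hij (by omega)]
      simp [doubleFanOne, doubleFan]
      omega
    · have := i.2
      simp only at hij; split_ifs at hij <;> omega
    · have := i.2
      have := j.2
      simp only at hij ⊢
      rw [h.adj_iff hlast (by split_ifs <;> omega) hij (by split_ifs <;> omega)]
      simp [doubleFanOne, doubleFan, Fin.ext_iff]
      split_ifs at hij ⊢ <;> omega
    · have := i.2
      have := j.2
      simp only at hij ⊢
      rw [h.adj_iff hlast (by split_ifs <;> omega) hij (by omega)]
      simp [doubleFanOne, doubleFan]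
      split_ifs at hij ⊢ <;> omega
    · have := i.2
      simp only at hij; omega
    · have := i.2
      have := j.2
      simp only at hij ⊢
      rw [h.adj_iff hlast (by omega) hij (by split_ifs <;> omega)]
      simp [doubleFanOne, doubleFan]
      split_ifs at hij ⊢ <;> omega
    · have := i.2
      have := j.2
      simp only at hij ⊢
      rw [h.adj_iff hlast (by omega) hij (by omega)]
      simp [doubleFanOne, doubleFan, Fin.ext_iff]
      omega

end IsHubLabelling

/-! ### General position sets of the extremal graphs -/

section GeneralPosition

variable {V W : Type*} {G : SimpleGraph V} {H : SimpleGraph W}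

theorem card_le_gpNumber [Fintype V] {R : Finset V} (hR : IsGeneralPosition G R) :
    R.card ≤ gpNumber G :=
  le_csSup ⟨Fintype.card V, by rintro _ ⟨S, -, rfl⟩; exact S.card_le_univ⟩ ⟨R, hR, rfl⟩

theorem exists_card_eq_gpNumber [Fintype V] (G : SimpleGraph V) :
    ∃ R : Finset V, IsGeneralPosition G R ∧ R.card = gpNumber G := by
  refine Nat.sSup_mem (s := {k : ℕ | ∃ R : Finset V, IsGeneralPosition G R ∧ R.card = k}) ?_ ?_
  · exact ⟨0, ∅, by simp [IsGeneralPosition], rfl⟩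
  · exact ⟨Fintype.card V, by rintro _ ⟨S, -, rfl⟩; exact S.card_le_univ⟩

theorem SimpleGraph.Hom.dist_le (f : G →g H) {x y : V} (h : G.Reachable x y) :
    H.dist (f x) (f y) ≤ G.dist x y := by
  obtain ⟨w, hw⟩ := h.exists_walk_length_eq_dist
  rw [← hw, ← w.length_map f]
  exact SimpleGraph.dist_le _

theorem SimpleGraph.Iso.dist_eq_of_reachable (φ : G ≃g H) {x y : V} (h : G.Reachable x y) :
    H.dist (φ x) (φ y) = G.dist x y := by
  refine le_antisymm (SimpleGraph.Hom.dist_le φ.toHom h) ?_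
  have := SimpleGraph.Hom.dist_le φ.symm.toHom (h.map φ.toHom)
  simpa using this

theorem IsGeneralPosition.of_iso (φ : G ≃g H) {R : Finset W} (hR : IsGeneralPosition H R) :
    IsGeneralPosition G (R.map φ.symm.toEquiv.toEmbedding) := by
  have hmem : ∀ x, x ∈ R.map φ.symm.toEquiv.toEmbedding → φ x ∈ R := by
    intro x hx
    obtain ⟨y, hy, rfl⟩ := Finset.mem_map.1 hx
    simpa using hy
  intro x hx y hy z hz hxy hyz hxz w hw hmem'
  refine hR _ (hmem x hx) _ (hmem y hy) _ (hmem z hz) (φ.injective.ne hxy) (φ.injective.ne hyz)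
    (φ.injective.ne hxz) (w.map φ.toHom) ?_ ?_
  · rw [SimpleGraph.Walk.length_map, hw]
    exact (φ.dist_eq_of_reachable w.reachable).symm
  · rw [SimpleGraph.Walk.support_map]
    exact List.mem_map_of_mem hmem'

theorem card_le_gpNumber_of_iso [Fintype V] (φ : G ≃g H) {R : Finset W}
    (hR : IsGeneralPosition H R) : R.card ≤ gpNumber G := by
  have := card_le_gpNumber (hR.of_iso φ)
  rwa [Finset.card_map] at this

theorem exists_adj_adj_of_dist_eq_two {x z : V} (h : G.dist x z = 2) :
    ∃ y, G.Adj x y ∧ G.Adj y z := by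
  obtain ⟨w, hw⟩ :=
    (SimpleGraph.Reachable.of_dist_ne_zero (by omega : G.dist x z ≠ 0)).exists_walk_length_eq_dist
  rw [h] at hw
  match w, hw with
  | .cons h₁ (.cons h₂ .nil), _ => exact ⟨_, h₁, h₂⟩

theorem dist_le_two {x y z : V} (h₁ : G.Adj x y) (h₂ : G.Adj y z) : G.dist x z ≤ 2 :=
  SimpleGraph.dist_le (.cons h₁ (.cons h₂ .nil))

/-- A criterion for general position in a set of diameter at most three. -/
theorem isGeneralPosition_of_dist_le_three {R : Finset V}
    (hd : ∀ x ∈ R, ∀ z ∈ R, G.dist x z ≤ 3)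
    (h₁ : ∀ x ∈ R, ∀ y ∈ R, ∀ z ∈ R, x ≠ z → G.Adj x y → G.Adj y z → G.Adj x z)
    (h₂ : ∀ x ∈ R, ∀ y ∈ R, ∀ z ∈ R, ∀ w, G.Adj x y → G.Adj y w → G.Adj w z → G.dist x z ≤ 2) :
    IsGeneralPosition G R := by
  refine isGeneralPosition_of_dist_add_dist_ne fun x hx y hy z hz hxy hyz hxz rxy ryz he => ?_
  have p1 := rxy.pos_dist_of_ne hxy
  have p2 := ryz.pos_dist_of_ne hyz
  have p3 := hd x hx z hz
  rcases (show (G.dist x y = 1 ∧ G.dist y z = 1) ∨ (G.dist x y = 1 ∧ G.dist y z = 2) ∨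
      (G.dist x y = 2 ∧ G.dist y z = 1) by omega) with ⟨h3, h4⟩ | ⟨h3, h4⟩ | ⟨h3, h4⟩
  · have := h₁ x hx y hy z hz hxz (SimpleGraph.dist_eq_one_iff_adj.1 h3)
      (SimpleGraph.dist_eq_one_iff_adj.1 h4)
    rw [← SimpleGraph.dist_eq_one_iff_adj] at this
    omega
  · obtain ⟨w, h5, h6⟩ := exists_adj_adj_of_dist_eq_two h4
    have := h₂ x hx y hy z hz w (SimpleGraph.dist_eq_one_iff_adj.1 h3) h5 h6
    omega
  · obtain ⟨w, h5, h6⟩ := exists_adj_adj_of_dist_eq_two h3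
    have := h₂ z hz y hy x hx w (SimpleGraph.dist_eq_one_iff_adj.1 h4).symm h6.symm h5.symm
    rw [SimpleGraph.dist_comm] at this
    omega

theorem isGeneralPosition_of_dist_le_two {R : Finset V}
    (hd : ∀ x ∈ R, ∀ z ∈ R, G.dist x z ≤ 2)
    (h₁ : ∀ x ∈ R, ∀ y ∈ R, ∀ z ∈ R, x ≠ z → G.Adj x y → G.Adj y z → G.Adj x z) :
    IsGeneralPosition G R :=
  isGeneralPosition_of_dist_le_three (fun x hx z hz => (hd x hx z hz).trans (by norm_num)) h₁
    fun x hx _ _ z hz _ _ _ _ => hd x hx z hz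

end GeneralPosition

/-- Choose the path indices `0, 1, 3, 4, 6, 7, …`: no three are consecutive, and all distances are
at most 2 through the centre. -/
theorem fan_gp (n : ℕ) (hn : 2 ≤ n) :
    ∃ R, IsGeneralPosition (fan (n - 1)) R ∧ R.card = 2 * n / 3 := by
  have hlt : ∀ j : Fin (2 * n / 3), 3 * (j.val / 2) + j.val % 2 < n - 1 := fun j => by
    have := j.2; omega
  let f : Fin (2 * n / 3) ↪ Option (Fin (n - 1)) :=
    ⟨fun j => some ⟨3 * (j.val / 2) + j.val % 2, hlt j⟩, fun i j hij => by
      simp only [Option.some.injEq, Fin.mk.injEq] at hij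
      apply Fin.ext
      omega⟩
  have hR : ∀ x ∈ Finset.univ.map f, ∃ l : Fin (n - 1), x = some l ∧ l.val % 3 ≠ 2 := by
    intro x hx
    simp only [Finset.mem_map, Finset.mem_univ, true_and] at hx
    obtain ⟨j, rfl⟩ := hx
    exact ⟨_, rfl, by simp only; omega⟩
  refine ⟨Finset.univ.map f, isGeneralPosition_of_dist_le_two ?_ ?_, by simp⟩
  · intro x hx z hz
    obtain ⟨i, rfl, -⟩ := hR x hx
    obtain ⟨j, rfl, -⟩ := hR z hz
    exact dist_le_two (y := none) (by simp [fan]) (by simp [fan])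
  · intro x hx y hy z hz hxz h1 h2
    obtain ⟨i, rfl, hi⟩ := hR x hx
    obtain ⟨j, rfl, hj⟩ := hR y hy
    obtain ⟨k, rfl, hk⟩ := hR z hz
    simp only [fan, ne_eq, Option.some.injEq, Fin.ext_iff, SimpleGraph.fromRel_adj] at hxz h1 h2
    omega

/-- The fan pattern on `n - 2` path vertices suffices: for `n ≡ 1` modulo 3 that path still has room
for `⌊2n/3⌋` of them, and the extra vertex is left out. -/
theorem quasiFan_gp (i n : ℕ) (hn : 4 ≤ n) (hmod : n % 3 = 1) :
    ∃ R, IsGeneralPosition (quasiFan i n) R ∧ R.card = 2 * n / 3 := by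
  have hlt : ∀ j : Fin (2 * n / 3), 3 * (j.val / 2) + j.val % 2 < n - 2 := fun j => by
    have := j.2; omega
  let f : Fin (2 * n / 3) ↪ Option (Option (Fin (n - 2))) :=
    ⟨fun j => some (some ⟨3 * (j.val / 2) + j.val % 2, hlt j⟩), fun i j hij => by
      simp only [Option.some.injEq, Fin.mk.injEq] at hij
      apply Fin.ext
      omega⟩
  have hR : ∀ x ∈ Finset.univ.map f, ∃ l : Fin (n - 2), x = some (some l) ∧ l.val % 3 ≠ 2 := by
    intro x hx
    simp only [Finset.mem_map, Finset.mem_univ, true_and] at hx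
    obtain ⟨j, rfl⟩ := hx
    exact ⟨_, rfl, by simp only; omega⟩
  refine ⟨Finset.univ.map f, isGeneralPosition_of_dist_le_two ?_ ?_, by simp⟩
  · intro x hx z hz
    obtain ⟨i, rfl, -⟩ := hR x hx
    obtain ⟨j, rfl, -⟩ := hR z hz
    exact dist_le_two (y := some none) (by simp [quasiFan, fan]) (by simp [quasiFan, fan])
  · intro x hx y hy z hz hxz h1 h2
    obtain ⟨i, rfl, hi⟩ := hR x hx
    obtain ⟨j, rfl, hj⟩ := hR y hy
    obtain ⟨k, rfl, hk⟩ := hR z hz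
    simp only [quasiFan, fan, ne_eq, Option.some.injEq, Fin.ext_iff,
      SimpleGraph.fromRel_adj] at hxz h1 h2
    omega

namespace DoubleFanVertex

variable {t n : ℕ}

theorem adj_v_p (l : Fin (3 * t)) : (doubleFanOne 1 t n).Adj .v (.p l) := by
  simp [doubleFanOne, doubleFan]

theorem not_adj_v_u (l : Fin (n - 3 * t - 1)) : ¬ (doubleFanOne 1 t n).Adj .v (.u l) := by
  simp [doubleFanOne, doubleFan]

theorem adj_p_p (l l' : Fin (3 * t)) :
    (doubleFanOne 1 t n).Adj (.p l) (.p l') ↔ l.val + 1 = l'.val ∨ l'.val + 1 = l.val := by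
  simp [doubleFanOne, doubleFan, Fin.ext_iff]
  omega

theorem adj_u_u (l l' : Fin (n - 3 * t - 1)) :
    (doubleFanOne 1 t n).Adj (.u l) (.u l') ↔ l.val + 1 = l'.val ∨ l'.val + 1 = l.val := by
  simp [doubleFanOne, doubleFan, Fin.ext_iff]
  omega

theorem adj_p_u (l : Fin (3 * t)) (l' : Fin (n - 3 * t - 1)) :
    (doubleFanOne 1 t n).Adj (.p l) (.u l') ↔ l.val = 1 ∨ (l.val = 0 ∧ l'.val = 0) := by
  simp [doubleFanOne, doubleFan]

end DoubleFanVertex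

open DoubleFanVertex in
theorem doubleFanOne_gp (t n : ℕ) (hmod : n % 3 = 1) (ht : 1 ≤ t) (htn : t + 1 ≤ n / 3) :
    ∃ R, IsGeneralPosition (doubleFanOne 1 t n) R ∧ R.card = 2 * n / 3 := by
  obtain ⟨s, hs⟩ : ∃ s, n = 3 * t + 1 + 3 * s := ⟨n / 3 - t, by omega⟩
  -- First path: indices `0, 2, 4, 5, 7, 8, …`, skipping the shared centre at index 1. Second path:
  -- `1, 2, 4, 5, …`, skipping index 0, which is adjacent to index 0 of the first path.
  have hltp : ∀ j : Fin (2 * t), (if j.val = 0 then 0 else 3 * (j.val / 2) + 1 + j.val % 2) < 3 * t :=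
    fun j => by have := j.2; split_ifs <;> omega
  have hltu : ∀ j : Fin (2 * s), 3 * (j.val / 2) + 1 + j.val % 2 < n - 3 * t - 1 :=
    fun j => by have := j.2; omega
  let f : Fin (2 * t) ⊕ Fin (2 * s) ↪ DoubleFanVertex (3 * t) (n - 3 * t - 1) :=
    ⟨fun j => match j with
      | .inl j => .p ⟨_, hltp j⟩
      | .inr j => .u ⟨_, hltu j⟩, by
      rintro (i | i) (j | j) hij
      · simp only [p.injEq, Fin.mk.injEq] at hij
        congr 1
        apply Fin.ext
        split_ifs at hij <;> omega
      · simp at hij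
      · simp at hij
      · simp only [u.injEq, Fin.mk.injEq] at hij
        congr 1
        apply Fin.ext
        omega⟩
  have hR : ∀ x ∈ Finset.univ.map f, (∃ l : Fin (3 * t), x = .p l ∧
      (l.val = 0 ∨ (2 ≤ l.val ∧ l.val % 3 ≠ 0))) ∨
      (∃ l : Fin (n - 3 * t - 1), x = .u l ∧ l.val % 3 ≠ 0) := by
    intro x hx
    simp only [Finset.mem_map, Finset.mem_univ, true_and] at hx
    obtain ⟨j | j, rfl⟩ := hx
    · refine Or.inl ⟨_, rfl, ?_⟩
      simp only
      split_ifs <;> omega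
    · exact Or.inr ⟨_, rfl, by simp only; omega⟩
  have h1t : 1 < 3 * t := by omega
  refine ⟨Finset.univ.map f, ?_, by simp; omega⟩
  have dpp : ∀ l l', (doubleFanOne 1 t n).dist (.p l) (.p l') ≤ 2 := fun l l' =>
    dist_le_two (adj_v_p l).symm (adj_v_p l')
  have duu : ∀ l l', (doubleFanOne 1 t n).dist (.u l) (.u l') ≤ 2 := fun l l' =>
    dist_le_two ((adj_p_u ⟨1, h1t⟩ l).2 (Or.inl rfl)).symm ((adj_p_u ⟨1, h1t⟩ l').2 (Or.inl rfl))
  have dpu : ∀ l l', (doubleFanOne 1 t n).dist (.p l) (.u l') ≤ 3 := fun l l' =>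
    SimpleGraph.dist_le (.cons (adj_v_p l).symm (.cons (adj_v_p ⟨1, h1t⟩)
      (.cons ((adj_p_u ⟨1, h1t⟩ l').2 (Or.inl rfl)) .nil)))
  apply isGeneralPosition_of_dist_le_three
  · intro x hx z hz
    rcases hR x hx with ⟨l, rfl, -⟩ | ⟨l, rfl, -⟩ <;> rcases hR z hz with ⟨m, rfl, -⟩ | ⟨m, rfl, -⟩
    · exact (dpp l m).trans (by norm_num)
    · exact dpu l m
    · rw [SimpleGraph.dist_comm]; exact dpu m l
    · exact (duu l m).trans (by norm_num)
  · intro x hx y hy z hz hxz h1 h2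
    rcases hR x hx with ⟨l, rfl, hl⟩ | ⟨l, rfl, hl⟩ <;>
      rcases hR y hy with ⟨m, rfl, hm⟩ | ⟨m, rfl, hm⟩ <;>
      rcases hR z hz with ⟨o, rfl, ho⟩ | ⟨o, rfl, ho⟩ <;>
      simp only [adj_p_p, adj_p_u, adj_u_u, SimpleGraph.adj_comm _ (u _) (p _), ne_eq, p.injEq,
        u.injEq, Fin.ext_iff] at h1 h2 hxz ⊢ <;> omega
  · intro x hx y hy z hz w h1 h2 h3
    rcases hR z hz with ⟨o, rfl, ho⟩ | ⟨o, rfl, ho⟩ <;>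
      rcases hR x hx with ⟨l, rfl, hl⟩ | ⟨l, rfl, hl⟩
    · exact dpp l o
    · have key : o.val = 2 ∨ o.val = 0 := by
        rcases hR y hy with ⟨m, rfl, hm⟩ | ⟨m, rfl, hm⟩ <;>
        rcases w with _ | w | w <;>
        simp only [adj_p_p, adj_p_u, adj_u_u, not_adj_v_u, SimpleGraph.adj_comm _ (u _) (p _),
          SimpleGraph.adj_comm _ (u _) v] at h1 h2 h3 <;> omega
      exact dist_le_two (y := .p ⟨1, h1t⟩)
        (((adj_p_u ⟨1, h1t⟩ l).2 (Or.inl rfl)).symm) ((adj_p_p _ _).2 (by simp only; omega))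
    · exfalso
      rcases hR y hy with ⟨m, rfl, hm⟩ | ⟨m, rfl, hm⟩ <;>
        rcases w with _ | w | w <;>
        simp only [adj_p_p, adj_p_u, adj_u_u, not_adj_v_u, SimpleGraph.adj_comm _ (u _) (p _),
          SimpleGraph.adj_comm _ (u _) v] at h1 h2 h3 <;> omega
    · exact duu l o

/-- Reversing both paths exchanges the two graphs obtained from the double fan. -/
theorem nonempty_iso_doubleFanTwo (t n : ℕ) :
    Nonempty (doubleFanTwo t t n ≃g doubleFanOne 1 t n) := by
  let r : DoubleFanVertex (3 * t) (n - 3 * t - 1) → DoubleFanVertex (3 * t) (n - 3 * t - 1) :=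
    fun w => match w with
    | .v => .v
    | .p l => .p l.rev
    | .u l => .u l.rev
  have hr : Function.Involutive r := by
    rintro (_ | l | l) <;> simp [r]
  refine ⟨⟨hr.toPerm, ?_⟩⟩
  rintro (_ | i | i) (_ | j | j) <;>
    simp [r, doubleFanOne, doubleFanTwo, doubleFan, Fin.ext_iff, Fin.val_rev] <;>
    first
      | done
      | have := i.2
        have := j.2
        omega

theorem doubleFanTwo_gp (t n : ℕ) (hmod : n % 3 = 1) (ht : 1 ≤ t) (htn : t + 1 ≤ n / 3) :
    ∃ R, IsGeneralPosition (doubleFanTwo t t n) R ∧ R.card = 2 * n / 3 := by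
  obtain ⟨R, hR, hcard⟩ := doubleFanOne_gp t n hmod ht htn
  obtain ⟨φ⟩ := nonempty_iso_doubleFanTwo t n
  exact ⟨_, hR.of_iso φ, by rw [Finset.card_map, hcard]⟩

/-! ### Striped polygons with small general position number -/

theorem isGeneralPosition_of_pairwise_adj {V : Type*} {G : SimpleGraph V} {R : Finset V}
    (h : ∀ x ∈ R, ∀ y ∈ R, x ≠ y → G.Adj x y) : IsGeneralPosition G R := by
  refine isGeneralPosition_of_dist_add_dist_ne fun x hx y hy z hz hxy hyz hxz _ _ he => ?_
  rw [SimpleGraph.dist_eq_one_iff_adj.2 (h x hx y hy hxy),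
    SimpleGraph.dist_eq_one_iff_adj.2 (h y hy z hz hyz),
    SimpleGraph.dist_eq_one_iff_adj.2 (h x hx z hz hxz)] at he
  omega

theorem IsHubLabelling.three_le_gpNumber {V : Type*} [Fintype V] {G : SimpleGraph V} {n k : ℤ}
    {p : ℤ → V} (h : IsHubLabelling G n p k) : 3 ≤ gpNumber G := by
  classical
  have hk := h.three_le
  have h01 := h.adj_zero 1 le_rfl (by omega)
  have h02 := h.adj_zero 2 (by omega) (by omega)
  have h12 := h.adj_succ h.one_lt 1
  rw [one_add_one_eq_two] at h12
  rw [← Finset.card_eq_three.2 ⟨p 0, p 1, p 2, h01.ne, h02.ne, h12.ne, rfl⟩]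
  apply card_le_gpNumber
  apply isGeneralPosition_of_pairwise_adj
  simp only [Finset.mem_insert, Finset.mem_singleton]
  rintro x (rfl | rfl | rfl) y (rfl | rfl | rfl) hxy <;>
    first
      | exact absurd rfl hxy
      | assumption
      | exact SimpleGraph.Adj.symm (by assumption)

namespace IsStripedPolygon

variable {V : Type*} {G : SimpleGraph V} {n : ℤ} {p : ℤ → V}

/-- A vertex with five neighbours gives rise to four vertices in general position. -/
theorem four_le_gpNumber [Fintype V] (h : IsStripedPolygon G n p) {a c₁ c₂ c₃ c₄ c₅ : ℤ}
    (h0 : a < c₁) (h12 : c₁ < c₂) (h23 : c₂ < c₃) (h34 : c₃ < c₄) (h45 : c₄ < c₅) (h5 : c₅ < a + n)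
    (a₁ : G.Adj (p a) (p c₁)) (a₂ : G.Adj (p a) (p c₂)) (a₃ : G.Adj (p a) (p c₃))
    (a₄ : G.Adj (p a) (p c₄)) (a₅ : G.Adj (p a) (p c₅)) : 4 ≤ gpNumber G := by
  classical
  -- The middle neighbour is omitted; its chord separates the pairs `c₁, c₂` and `c₄, c₅`, so
  -- adjacency among the four stays within a pair.
  have hcross : ∀ i j, a < i → i < c₃ → c₃ < j → j < a + n → ¬ G.Adj (p i) (p j) :=
    fun i j h1 h2 h3 h4 => h.noncrossing a c₃ i j h1 h2 h3 h4 a₃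
  have hR : ∀ x ∈ ({p c₁, p c₂, p c₄, p c₅} : Finset V), ∃ i, (i = c₁ ∨ i = c₂ ∨ i = c₄ ∨ i = c₅) ∧
      p i = x := by
    simp only [Finset.mem_insert, Finset.mem_singleton]
    rintro x (rfl | rfl | rfl | rfl)
    exacts [⟨_, by simp, rfl⟩, ⟨_, by simp, rfl⟩, ⟨_, by simp, rfl⟩, ⟨_, by simp, rfl⟩]
  have hcard : ({p c₁, p c₂, p c₄, p c₅} : Finset V).card = 4 := by
    rw [Finset.card_insert_of_notMem, Finset.card_eq_three.2
      ⟨p c₂, p c₄, p c₅, h.ne_of_lt (by omega) (by omega), h.ne_of_lt (by omega) (by omega),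
        h.ne_of_lt (by omega) (by omega), rfl⟩]
    simp only [Finset.mem_insert, Finset.mem_singleton, not_or]
    exact ⟨h.ne_of_lt (by omega) (by omega), h.ne_of_lt (by omega) (by omega),
      h.ne_of_lt (by omega) (by omega)⟩
  rw [← hcard]
  apply card_le_gpNumber
  have hadj : ∀ i, (i = c₁ ∨ i = c₂ ∨ i = c₄ ∨ i = c₅) → G.Adj (p a) (p i) := by
    rintro i (rfl | rfl | rfl | rfl) <;> assumption
  have hbound : ∀ i, (i = c₁ ∨ i = c₂ ∨ i = c₄ ∨ i = c₅) → a < i ∧ i < a + n ∧ i ≠ c₃ := by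
    intro i hi; omega
  apply isGeneralPosition_of_dist_le_two
  · intro x hx z hz
    obtain ⟨i, hi, rfl⟩ := hR x hx
    obtain ⟨j, hj, rfl⟩ := hR z hz
    exact dist_le_two (hadj i hi).symm (hadj j hj)
  · intro x hx y hy z hz hxz h1 h2
    have hside : ∀ i j, (i = c₁ ∨ i = c₂ ∨ i = c₄ ∨ i = c₅) → (j = c₁ ∨ j = c₂ ∨ j = c₄ ∨ j = c₅) →
        G.Adj (p i) (p j) → (i < c₃ ↔ j < c₃) := by
      intro i j hi hj hij
      have b1 := hbound i hi
      have b2 := hbound j hj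
      by_contra hcon
      rcases (show (i < c₃ ∧ c₃ < j) ∨ (j < c₃ ∧ c₃ < i) by omega) with ⟨h3, h4⟩ | ⟨h3, h4⟩
      · exact hcross i j b1.1 h3 h4 b2.2.1 hij
      · exact hcross j i b2.1 h3 h4 b1.2.1 hij.symm
    obtain ⟨i, hi, rfl⟩ := hR x hx
    obtain ⟨j, hj, rfl⟩ := hR y hy
    obtain ⟨l, hl, rfl⟩ := hR z hz
    have s1 := hside i j hi hj h1
    have s2 := hside j l hj hl h2
    have n1 : i ≠ j := by rintro rfl; exact h1.ne rfl
    have n2 : j ≠ l := by rintro rfl; exact h2.ne rfl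
    have n3 : i ≠ l := by rintro rfl; exact hxz rfl
    omega

/-- Without vertices of degree at least five the triangulation proceeds in a zigzag. -/
theorem adj_zigzag [Fintype V] (h : IsStripedPolygon G n p) (hgp : gpNumber G ≤ 3) {a b : ℤ}
    (hab : a + 2 < b) (hb : b + 2 ≤ a + n) (h1 : G.Adj (p a) (p (b - 1))) (h2 : G.Adj (p a) (p b)) :
    G.Adj (p b) (p (a - 1)) := by
  have h3 := h2.symm
  rw [← h.apply_add a] at h3
  obtain ⟨c, h4, h5, h6, h7⟩ := h.exists_triangle hb (by omega) h3
  rw [h.apply_add] at h7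
  have e := h.apply_add (a - 1)
  by_cases hc : c = a - 1 + n
  · rwa [hc, e] at h6
  · exfalso
    have := h.striped a b c (by omega) h4 h5 h2 h6 h7.symm
    obtain rfl : c = b + 1 := by omega
    have h8 := (h.adj_pred (by omega) a).symm
    rw [← e] at h8
    have := h.four_le_gpNumber (a := a) (c₁ := a + 1) (c₂ := b - 1) (c₃ := b) (c₄ := b + 1)
      (c₅ := a - 1 + n) (by omega) (by omega) (by omega) (by omega) (by omega) (by omega)
      (h.adj_succ (by omega) a) h1 h2 h7.symm h8
    omega

/-- A polygon that is triangulated by a zigzag is a straight linear 2-tree. -/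
theorem nonempty_iso_straight {n : ℕ} (h : IsStripedPolygon G n p) (hn : 2 ≤ n)
    (hR₁ : ∀ i : ℕ, 1 ≤ i → 2 * i < n → G.Adj (p (-i)) (p i))
    (hR₂ : ∀ i : ℕ, 2 * i + 1 < n → G.Adj (p (-i)) (p (i + 1))) :
    Nonempty (G ≃g straightLinearTwoTree n) := by
  have hadj₀ : ∀ i j : ℕ, j < i → 2 * i < n → (G.Adj (p (-i)) (p (-j)) ↔ i = j + 1) := by
    intro i j hji hi
    constructor
    · intro hadj
      by_contra hcon
      have := hR₁ (j + 1) (by omega) (by omega)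
      exact h.noncrossing (-(j + 1 : ℕ)) (j + 1 : ℕ) (-j) (-i + n) (by omega) (by omega) (by omega)
        (by omega) this (by rw [h.apply_add]; exact hadj.symm)
    · rintro rfl
      have := h.adj_pred (by omega) (-j)
      rwa [show (-(j : ℤ) - 1) = -((j + 1 : ℕ) : ℤ) by omega] at this
  have hadj₁ : ∀ i j : ℕ, 1 ≤ i → i < j → 2 * j ≤ n → (G.Adj (p i) (p j) ↔ j = i + 1) := by
    intro i j hi hij hj
    constructor
    · intro hadj
      by_contra hcon
      exact h.noncrossing (-i) (i + 1) i j (by omega) (by omega) (by omega)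
        (by omega) (hR₂ i (by omega)) hadj
    · rintro rfl
      exact h.adj_succ (by omega) i
  have hadj₂ : ∀ i j : ℕ, 2 * i < n → 1 ≤ j → 2 * j ≤ n →
      (G.Adj (p (-i)) (p j) ↔ j = i ∨ j = i + 1) := by
    intro i j hi hj hjn
    constructor
    · intro hadj
      by_contra hcon
      rcases (show i + 2 ≤ j ∨ j < i by omega) with h1 | h1
      · exact h.noncrossing (-(i + 1 : ℕ)) (i + 1 : ℕ) (-i) j (by omega) (by omega) (by omega)
          (by omega) (hR₁ (i + 1) (by omega) (by omega)) hadj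
      · exact h.noncrossing (-j) (j + 1) j (-i + n) (by omega) (by omega) (by omega)
          (by omega) (hR₂ j (by omega)) (by rw [h.apply_add]; exact hadj.symm)
    · rintro (rfl | rfl)
      · exact hR₁ j hj hi
      · exact hR₂ i (by omega)
  -- The zigzag order is `0, 1, -1, 2, -2, …`; the shift below moves these labels into `0, …, n -
  -- 1`.
  let s : Fin n → ℤ := fun m => if m.val % 2 = 0 then -((m.val / 2 : ℕ) : ℤ) else (m.val / 2 + 1 : ℕ)
  refine (h.shift (-((n - 1) / 2 : ℕ))).nonempty_iso (by omega)
    (fun m => s m + ((n - 1) / 2 : ℕ)) ?_ ?_ ?_ ?_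
  · intro m
    have := m.2
    simp only [s]
    split_ifs <;> omega
  · intro a b hab
    apply Fin.ext
    simp only [s] at hab
    split_ifs at hab <;> omega
  · intro i h1 h2
    by_cases h3 : i ≤ ((n - 1) / 2 : ℕ)
    · refine ⟨⟨2 * (((n - 1) / 2 : ℕ) - i).toNat, by omega⟩, ?_⟩
      simp only [s]
      split_ifs <;> omega
    · refine ⟨⟨2 * (i - ((n - 1) / 2 : ℕ)).toNat - 1, by omega⟩, ?_⟩
      simp only [s]
      split_ifs <;> omega
  · intro a b hab
    have ha := a.2
    have hb := b.2
    simp only [add_neg_cancel_right, straightLinearTwoTree, SimpleGraph.fromRel_adj, ne_eq,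
      Fin.ext_iff]
    simp only [s] at hab ⊢
    split_ifs at hab ⊢ with h1 h2 h2
    · rw [hadj₀ _ _ (by omega) (by omega)]
      omega
    · rw [hadj₂ _ _ (by omega) (by omega) (by omega)]
      omega
    · omega
    · rw [hadj₁ _ _ (by omega) (by omega) (by omega)]
      omega

end IsStripedPolygon

theorem IsHubLabelling.nonempty_iso_straight {V : Type*} [Fintype V] {G : SimpleGraph V} {n : ℕ}
    {k : ℤ} {p : ℤ → V} (h : IsHubLabelling G n p k) (hgp : gpNumber G ≤ 3) :
    Nonempty (G ≃g straightLinearTwoTree n) := by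
  have hk := h.three_le
  have hkn := h.le
  -- The zigzag starts at the ear, moved to label 0. Each round applies `adj_zigzag` once directly
  -- and once in the reflected polygon.
  have hs := h.shift 1
  have key : ∀ i : ℕ, 1 ≤ i → (2 * i < n → G.Adj (p (-i + 1)) (p (i + 1))) ∧
      (2 * i + 1 < n → G.Adj (p (-i + 1)) (p (i + 1 + 1))) := by
    intro i hi
    induction i, hi using Nat.le_induction with
    | base =>
      exact ⟨fun _ => h.adj_zero 2 (by omega) (by omega), fun _ => h.adj_zero 3 (by omega) hk⟩
    | succ i hi ih =>
      have h1 : 2 * (i + 1) < n → G.Adj (p (-(i + 1 : ℕ) + 1)) (p ((i + 1 : ℕ) + 1)) := by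
        intro h2
        have := hs.adj_zigzag hgp (a := -i) (b := i + 1) (by omega) (by omega)
          (by simpa using ih.1 (by omega)) (ih.2 (by omega))
        push_cast
        rw [neg_add, ← sub_eq_add_neg]
        exact this.symm
      refine ⟨h1, fun h2 => ?_⟩
      have := hs.reflect.adj_zigzag hgp (a := -(i + 1 : ℕ)) (b := (i + 1 : ℕ)) (by omega)
        (by omega) ?_ ?_
      · rwa [show -(-((i + 1 : ℕ) : ℤ) - 1) = (i + 1 : ℕ) + 1 by ring] at this
      · have h3 := (ih.2 (by omega)).symm
        push_cast
        simpa using h3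
      · have h3 := (h1 (by omega)).symm
        simpa using h3
  refine hs.nonempty_iso_straight (by omega) (fun i hi hin => (key i hi).1 hin) fun i hin => ?_
  rcases Nat.eq_zero_or_pos i with rfl | hi
  · exact hs.adj_succ (by omega) 0
  · exact (key i hi).2 hin

/-! ### The straight linear 2-tree -/

section Straight

variable {n : ℕ}

theorem exists_walk_straight (i j : Fin n) (hij : i ≤ j) :
    ∃ w : (straightLinearTwoTree n).Walk i j, w.length = (j.val - i.val + 1) / 2 := by
  obtain ⟨d, hd⟩ : ∃ d, d = j.val - i.val := ⟨_, rfl⟩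
  induction d using Nat.strong_induction_on generalizing i with
  | _ d ih =>
  rw [Fin.le_def] at hij
  rcases (show d = 0 ∨ d = 1 ∨ 2 ≤ d by omega) with rfl | rfl | h2
  · obtain rfl : i = j := Fin.ext (by omega)
    exact ⟨.nil, by simp⟩
  · have hadj : (straightLinearTwoTree n).Adj i j := by
      simp only [straightLinearTwoTree, SimpleGraph.fromRel_adj, ne_eq, Fin.ext_iff]
      omega
    exact ⟨hadj.toWalk, by rw [SimpleGraph.Walk.length_cons, SimpleGraph.Walk.length_nil]; omega⟩
  · have hj := j.2
    have hadj : (straightLinearTwoTree n).Adj i ⟨i + 2, by omega⟩ := by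
      simp only [straightLinearTwoTree, SimpleGraph.fromRel_adj, ne_eq, Fin.ext_iff]
      omega
    obtain ⟨w, hw⟩ := ih (d - 2) (by omega) ⟨i + 2, by omega⟩ (by rw [Fin.le_def]; simp only; omega)
      (by simp only; omega)
    exact ⟨.cons hadj w, by rw [SimpleGraph.Walk.length_cons, hw]; simp only; omega⟩

theorem le_length_straight {i j : Fin n} (w : (straightLinearTwoTree n).Walk i j) :
    j.val ≤ i.val + 2 * w.length := by
  induction w with
  | nil => simp
  | cons hadj w ih =>
    simp only [straightLinearTwoTree, SimpleGraph.fromRel_adj] at hadj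
    rw [SimpleGraph.Walk.length_cons]
    omega

theorem dist_straight {i j : Fin n} (hij : i ≤ j) :
    (straightLinearTwoTree n).dist i j = (j.val - i.val + 1) / 2 := by
  obtain ⟨w, hw⟩ := exists_walk_straight i j hij
  have h1 := SimpleGraph.dist_le w
  obtain ⟨w', hw'⟩ := w.reachable.exists_walk_length_eq_dist
  have h2 := le_length_straight w'
  omega

/-- `⌈x/2⌉ + ⌈y/2⌉ ≠ ⌈(x + y)/2⌉` only when `x` and `y` are both odd. Among four vertices two
adjacent odd gaps add up to an even one, which a triple also requires to be odd. -/
theorem IsGeneralPosition.card_le_three_of_straight {R : Finset (Fin n)}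
    (hR : IsGeneralPosition (straightLinearTwoTree n) R) : R.card ≤ 3 := by
  by_contra hcon
  obtain ⟨S, hSR, hS⟩ := Finset.exists_subset_card_eq (show 4 ≤ R.card by omega)
  have hpre : (straightLinearTwoTree n).Preconnected := by
    intro i j
    rcases le_total i j with h1 | h1
    · exact (exists_walk_straight i j h1).choose.reachable
    · exact (exists_walk_straight j i h1).choose.reachable.symm
  have key : ∀ a b c : Fin 4, a < b → b < c →
      ((S.orderEmbOfFin hS b).val - (S.orderEmbOfFin hS a).val) % 2 = 1 ∧
      ((S.orderEmbOfFin hS c).val - (S.orderEmbOfFin hS b).val) % 2 = 1 ∧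
      (S.orderEmbOfFin hS a).val < (S.orderEmbOfFin hS b).val ∧
      (S.orderEmbOfFin hS b).val < (S.orderEmbOfFin hS c).val := by
    intro a b c hab hbc
    have hG : (straightLinearTwoTree n).Connected :=
      { preconnected := hpre, nonempty := ⟨S.orderEmbOfFin hS a⟩ }
    have h1 := (S.orderEmbOfFin hS).strictMono hab
    have h2 := (S.orderEmbOfFin hS).strictMono hbc
    have := hR.dist_add_dist_ne hG (hSR (S.orderEmbOfFin_mem hS a))
      (hSR (S.orderEmbOfFin_mem hS b)) (hSR (S.orderEmbOfFin_mem hS c)) h1.ne h2.ne (h1.trans h2).ne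
    rw [dist_straight h1.le, dist_straight h2.le, dist_straight (h1.trans h2).le] at this
    rw [Fin.lt_def] at h1 h2
    omega
  have k1 := key 0 1 2 (by decide) (by decide)
  have k2 := key 0 1 3 (by decide) (by decide)
  have k3 := key 1 2 3 (by decide) (by decide)
  omega

end Straight

/-! ### Assembly of the theorem -/

theorem IsStripedPolygon.exists_hub_of_five_le {V : Type*} {G : SimpleGraph V} {n : ℤ} {p : ℤ → V}
    (h : IsStripedPolygon G n p) (hn : 5 ≤ n) : ∃ q k, IsHubLabelling G n q k := by
  have h0 := (h.adj_pred (by omega) n).symm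
  rw [h.apply_period] at h0
  obtain ⟨c, -, -, hc⟩ := h.exists_ear (n - 3).toNat (a := 0) (b := n - 1) (by omega) (by omega) h0
  obtain ⟨q, k, hq, -⟩ := h.exists_hub hn hc
  exact ⟨q, k, hq⟩

/-- The two equality clauses are merged: for `n ≢ 1` modulo 3 only the fan alternative can hold. -/
theorem mainTheorem2 {V : Type*} [Fintype V] (G : SimpleGraph V) (D : OuterplaneDrawing G)
    (n : ℕ) (hcard : Fintype.card V = n) (hn : 5 ≤ n)
    (hmax : IsMaximalOuterplanar G) (hstriped : D.IsStriped) :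
    3 ≤ gpNumber G ∧ gpNumber G ≤ 2 * n / 3 ∧
    (gpNumber G = 3 ↔ Nonempty (G ≃g straightLinearTwoTree n)) ∧
    (gpNumber G = 2 * n / 3 ↔
      Nonempty (G ≃g fan (n - 1)) ∨
      (n % 3 = 1 ∧
        (Nonempty (G ≃g quasiFan 1 n) ∨ Nonempty (G ≃g quasiFan (n - 3) n) ∨
          ∃ t : ℕ, 1 ≤ t ∧ t + 1 ≤ n / 3 ∧
            (Nonempty (G ≃g doubleFanOne 1 t n) ∨ Nonempty (G ≃g doubleFanTwo t t n))))) := by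
  obtain ⟨p, hp⟩ := exists_isStripedPolygon D hcard (by omega) hmax hstriped
  obtain ⟨q, k, hq⟩ := hp.exists_hub_of_five_le (by omega)
  obtain ⟨R, hR, hRcard⟩ := exists_card_eq_gpNumber G
  have hlower := hq.three_le_gpNumber
  have hupper : gpNumber G ≤ 2 * n / 3 := by
    by_contra hcon
    obtain ⟨_, _, -, h1⟩ := hp.exists_hub_of_card (by omega) hR (by omega) (by omega)
    omega
  refine ⟨hlower, hupper, ⟨fun h => hq.nonempty_iso_straight h.le, ?_⟩, ?_, ?_⟩
  · rintro ⟨φ⟩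
    have h1 := (hR.of_iso φ.symm).card_le_three_of_straight
    rw [Finset.card_map] at h1
    omega
  · intro heq
    -- For `n = 5` the bound is 3, below the four elements that the counting needs; here `3 ≤ k ≤ n
    -- - 2` already forces a fan.
    by_cases hn5 : n = 5
    · have h1 := hq.three_le
      have h2 := hq.le
      exact Or.inl (hq.nonempty_iso_fan (by omega))
    obtain ⟨q', k', hq', ⟨h1, -⟩ | ⟨h1, h2⟩⟩ :=
      hp.exists_hub_of_card (by omega) hR (by omega) (by omega)
    · exact Or.inl (hq'.nonempty_iso_fan h1)
    · have h3 := hq'.three_le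
      have h4 := hq'.le
      rcases h2 with h2 | ⟨h2, hlast⟩
      · exact Or.inr ⟨by omega, Or.inl (hq'.nonempty_iso_quasiFan h2.symm)⟩
      · by_cases hk : k' + 2 = n
        · exact Or.inl (hq'.nonempty_iso_fan hk)
        · obtain ⟨t, ht⟩ := h2
          lift t to ℕ using by omega
          exact Or.inr ⟨by omega, Or.inr (Or.inr ⟨t, by omega, by omega,
            Or.inl (hq'.nonempty_iso_doubleFanOne ht.symm hlast)⟩)⟩
  · have of_iso : ∀ {W : Type} {H : SimpleGraph W}, Nonempty (G ≃g H) →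
        (∃ S, IsGeneralPosition H S ∧ S.card = 2 * n / 3) → gpNumber G = 2 * n / 3 := by
      rintro W H ⟨φ⟩ ⟨S, hS, hScard⟩
      exact le_antisymm hupper (hScard ▸ card_le_gpNumber_of_iso φ hS)
    rintro (h | ⟨hmod, h | h | ⟨t, ht, htn, h | h⟩⟩)
    · exact of_iso h (fan_gp n (by omega))
    · exact of_iso h (quasiFan_gp 1 n (by omega) hmod)
    · exact of_iso h (quasiFan_gp (n - 3) n (by omega) hmod)
    · exact of_iso h (doubleFanOne_gp t n hmod ht htn)
    · exact of_iso h (doubleFanTwo_gp t n hmod ht htn)
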